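/- Let $K$ be a field with a product formula: a family $(|\cdot|_v)_{v\in M_K}$ of absolute values on $K$ and positive reals $(n_v)$ such that all but finitely many $|\cdot|_v$ are ultrametric, those that are not ultrametric are induced by embeddings $K\hookrightarrow\mathbb C$, and for every $x\in K^*$ one has $|x|_v=1$ for almost all $v$ and $\prod_v |x|_v^{n_v}=1$. Let $\overline K$ be an algebraic closure of $K$, let $\mathbb C_v$ be the completion of an algebraic closure of the completion $K_v$, and fix embeddings $\overline K\hookrightarrow\mathbb C_v$ over $K$. A finite subset of $\overline K$ is Galois-stable if it is stable under $\mathrm{Aut}(\overline K/K)$. Assume the Northcott property: for all $d$ and $B$ there are only finitely many $\alpha\in\overline K$ with $[K(\alpha):K]\le d$ and $h(\alpha)\le B$, where $h(\alpha)=\frac1{\#T}\sum_v\sum_{z\in T}n_v\log^+|z|_v$ with $T$ the smallest Galois-stable set containing $\alpha$. For a bounded subset $A$ of a metric space let $d_n(A)=\sup_{x_1,\dots,x_n\in A}\prod_{i\ne j}d(x_i,x_j)^{1/(n(n-1))}$, and let $c(A)=\lim_n d_n(A)$ be its transfinite diameter (with $c(\emptyset)=0$). For a closed bounded $F\subseteq\mathbb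 C_v$, a logarithmic distance function for $F$ is a continuous $\lambda:\mathbb C_v\to\mathbb R$ that vanishes on $F$, is positive off $F$, and for which $|\lambda(z)-\log^+|z|_v|$ is bounded. It is a generalized Green's function for $F$ if there are polynomials $P_n\in\mathbb C_v[z]$ of degrees $d_n\ge1$ and $R_n>0$ in the value group of $\mathbb C_v$ such that the sets $F_n=\{z:|P_n(z)|_v\le R_n\}$ are descending, $\bigcap_nF_n=F$, $c(F_n)\to c(F)$, and $\lambda(z)=\lim_n\frac1{d_n}\log^+\left(|P_n(z)|_v/R_n\right)$ for all $z$. Let $\mathbb F=(F_v)_v$ be an adelic set, i.e. $F_v\subseteq\mathbb C_v$ for every $v$ and $F_v$ is the closed unit disc for almost all $v$. For every $v$ let $F_v$ be closed and bounded and let $\lambda_v$ be a generalized Green's function for $F_v$. Assume that $c(\mathbb F):=\prod_v c(F_v)^{n_v}=1$. For a finite Galois-stable set $S\subset\overline K$ put $h_{\mathbb F}(S)=\frac1{\#S}\sum_v\sum_{z\in S}n_v\lambda_v(z)$. **Theorem.** Let $(S_n)$ be a sequence of distinct finite Galois-stable subsets of $\overline K$ whose elements are separable over $K$, with $h_{\mathbb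 F}(S_n)\to0$. Then for every $v\in M_K$ the sequence $(S_n)$ is pseudo-equidistributed with respect to $(F_v,\lambda_v)$; that is, with $N_n=\#S_n$, $$\frac1{N_n}\sum_{z\in S_n}\lambda_v(z)\to0,\qquad N_n\to\infty,\qquad \prod_{x,y\in S_n,\ x\ne y}|x-y|_v^{1/(N_n(N_n-1))}\to c(F_v).$$ -/

import Mathlib

open Filter Topology Polynomial

namespace AdelicCapacity

section Metric

/-- The `n`-th diameter `d_n(A)`: the supremum over `n`-tuples of points of `A` of the geometric
mean of the pairwise distances. -/
noncomputable def nthDiameter {X : Type*} [MetricSpace X] (A : Set X) (n : ℕ) : ℝ :=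
  ⨆ x : Fin n → A,
    (∏ p ∈ (Finset.univ : Finset (Fin n)).offDiag, dist (x p.1) (x p.2)) ^
      (1 / ((n : ℝ) * ((n : ℝ) - 1)))

/-- The transfinite diameter `c(A) = lim d_n(A)` of a (bounded) set; it is `0` for `A = ∅`. -/
noncomputable def transfiniteDiameter {X : Type*} [MetricSpace X] (A : Set X) : ℝ :=
  limUnder atTop (nthDiameter A)

open Classical in
/-- The geometric mean `d(T)` of the pairwise distances of the points of a finite set. -/
noncomputable def finsetDiameter {X : Type*} [MetricSpace X] (T : Finset X) : ℝ :=
  (∏ p ∈ T.offDiag, dist p.1 p.2) ^ (1 / ((T.card : ℝ) * ((T.card : ℝ) - 1)))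

end Metric

section Local

variable {L : Type*} [NormedField L]

/-- `lam` is a logarithmic distance function for `F`. -/
structure IsLogDistance (F : Set L) (lam : L → ℝ) : Prop where
  continuous : Continuous lam
  eq_zero : ∀ z ∈ F, lam z = 0
  pos : ∀ z ∉ F, 0 < lam z
  bounded : ∃ C : ℝ, ∀ z, |lam z - Real.posLog ‖z‖| ≤ C

/-- The lemniscate `{z : |P(z)| ≤ R}`. -/
def lemniscate (P : L[X]) (R : ℝ) : Set L := {z | ‖P.eval z‖ ≤ R}

/-- The function `(1/d) log⁺ |P(z)/R|`, `d = deg P`, that is, the Green's function of the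
lemniscate `{z : |P(z)| ≤ R}`. -/
noncomputable def lemniscateGreen (P : L[X]) (R : ℝ) (z : L) : ℝ :=
  1 / (P.natDegree : ℝ) * Real.posLog (‖P.eval z‖ / R)

/-- `lam` is a generalized Green's function for the closed and bounded set `F`: a logarithmic
distance function for `F` which is the pointwise limit of the Green's functions of a descending
sequence of lemniscates `{z : |P n (z)| ≤ R n}`, with `R n` in the value group, whose intersection
is `F` and whose transfinite diameters converge to that of `F`. -/
structure IsGeneralizedGreen (F : Set L) (lam : L → ℝ) : Prop where
  isClosed : IsClosed F
  isBounded : Bornology.IsBounded F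
  isLogDistance : IsLogDistance F lam
  exists_lemniscates : ∃ (P : ℕ → L[X]) (R : ℕ → ℝ),
    (∀ n, 0 < (P n).natDegree) ∧
    (∀ n, ∃ a : L, a ≠ 0 ∧ ‖a‖ = R n) ∧
    (∀ n, lemniscate (P (n + 1)) (R (n + 1)) ⊆ lemniscate (P n) (R n)) ∧
    (⋂ n, lemniscate (P n) (R n)) = F ∧
    Tendsto (fun n => transfiniteDiameter (lemniscate (P n) (R n))) atTop
      (𝓝 (transfiniteDiameter F)) ∧
    ∀ z, Tendsto (fun n => lemniscateGreen (P n) (R n) z) atTop (𝓝 (lam z))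

/-- The sequence `S` is `lam`-taut: the averages of `lam` over `S n` tend to `0`. -/
def IsTaut (lam : L → ℝ) (S : ℕ → Finset L) : Prop :=
  Tendsto (fun n => 1 / ((S n).card : ℝ) * ∑ z ∈ S n, lam z) atTop (𝓝 0)

/-- The sequence `S` is a generalized Fekete sequence for `F`. -/
def IsGeneralizedFekete (F : Set L) (S : ℕ → Finset L) : Prop :=
  Tendsto (fun n => (S n).card) atTop atTop ∧
    Tendsto (fun n => finsetDiameter (S n)) atTop (𝓝 (transfiniteDiameter F))

/-- The sequence `S` is pseudo-equidistributed with respect to the pair `(F, lam)`. -/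
def IsPseudoEquidistributed (F : Set L) (lam : L → ℝ) (S : ℕ → Finset L) : Prop :=
  IsTaut lam S ∧ IsGeneralizedFekete F S

end Local

section Global

/-- A field with a product formula: a family of absolute values indexed by the set `M` of places,
with positive weights `n_v`. -/
structure ProductFormula (K : Type*) [Field K] (M : Type*) where
  abv : M → AbsoluteValue K ℝ
  weight : M → ℝ
  weight_pos : ∀ v, 0 < weight v
  finite_not_ultrametric : {v | ¬ IsNonarchimedean (abv v)}.Finite
  exists_complex_embedding : ∀ v, ¬ IsNonarchimedean (abv v) →
    ∃ σ : K →+* ℂ, ∀ x, abv v x = ‖σ x‖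
  finite_ne_one : ∀ x : K, x ≠ 0 → {v | abv v x ≠ 1}.Finite
  prod_eq_one : ∀ x : K, x ≠ 0 → ∏ᶠ v, abv v x ^ weight v = 1

/-- An absolute value that is ultrametric or induced by a complex embedding extends to the
algebraic closure of the completion. -/
theorem exists_absoluteValue_extension {K : Type*} [Field K] (v : AbsoluteValue K ℝ)
    (h : ¬ IsNonarchimedean v → ∃ σ : K →+* ℂ, ∀ x, v x = ‖σ x‖) :
    ∃ w : AbsoluteValue (AlgebraicClosure v.Completion) ℝ,
      ∀ x : v.Completion, w (algebraMap _ _ x) = ‖x‖ := by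
  by_cases hv : IsNonarchimedean v
  · have hu : IsUltrametricDist v.Completion := by
      apply IsUltrametricDist.isUltrametricDist_of_isNonarchimedean_norm
      intro x y
      induction x, y using UniformSpace.Completion.induction_on₂ with
      | hp => exact isClosed_le (by fun_prop) (by fun_prop)
      | ih a b =>
        rw [← UniformSpace.Completion.coe_add]
        simp only [UniformSpace.Completion.norm_coe]
        exact hv a.ofAbs b.ofAbs
    by_cases hn : ∃ x : v.Completion, 1 < ‖x‖
    · let _ : NontriviallyNormedField v.Completion :=
        { (inferInstance : NormedField v.Completion) with non_trivial := hn }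
      let N := spectralMulAlgNorm v.Completion (AlgebraicClosure v.Completion)
      refine ⟨{ toFun := N, map_mul' := map_mul N, nonneg' := apply_nonneg N,
                eq_zero' := fun x => map_eq_zero_iff_eq_zero N, add_le' := map_add_le_add N },
        fun x => ?_⟩
      exact spectralNorm_extends x
    · push Not at hn
      classical
      refine ⟨AbsoluteValue.trivial, fun x => ?_⟩
      by_cases hx : x = 0
      · simp [hx]
      · have h1 := hn x
        have h2 := hn x⁻¹
        have h3 : 0 < ‖x‖ := norm_pos_iff.2 hx
        rw [norm_inv] at h2
        rw [AbsoluteValue.trivial_apply (by simpa using hx)]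
        exact le_antisymm ((inv_le_one₀ h3).1 h2) h1
  · obtain ⟨σ, hσ⟩ := h hv
    have hiso : Isometry (σ.comp (WithAbs.equiv v).toRingHom) := by
      refine AddMonoidHomClass.isometry_of_norm _ fun x => ?_
      exact (hσ x.ofAbs).symm
    let f : v.Completion →+* ℂ :=
      UniformSpace.Completion.extensionHom (σ.comp (WithAbs.equiv v).toRingHom) hiso.continuous
    have hf : ∀ x, ‖f x‖ = ‖x‖ := by
      have hi : Isometry f := hiso.completion_extension
      intro x
      simpa using hi.dist_eq x 0
    let _ : Algebra v.Completion ℂ := f.toAlgebra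
    let g : AlgebraicClosure v.Completion →ₐ[v.Completion] ℂ := IsAlgClosed.lift
    refine ⟨(NormedField.toAbsoluteValue ℂ).comp (f := g.toRingHom) g.toRingHom.injective,
      fun x => ?_⟩
    change ‖g (algebraMap _ _ x)‖ = ‖x‖
    rw [g.commutes]
    exact hf x

variable {K : Type*} [Field K] {M : Type*} (G : ProductFormula K M)

/-- The (unique) extension of `|·|_v` to the algebraic closure of the completion `K_v`. -/
noncomputable def ProductFormula.closureAbv (v : M) :
    AbsoluteValue (AlgebraicClosure (G.abv v).Completion) ℝ :=
  Classical.choose (exists_absoluteValue_extension (G.abv v) (G.exists_complex_embedding v))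

theorem ProductFormula.closureAbv_algebraMap (v : M) (x : (G.abv v).Completion) :
    G.closureAbv v (algebraMap _ _ x) = ‖x‖ :=
  Classical.choose_spec
    (exists_absoluteValue_extension (G.abv v) (G.exists_complex_embedding v)) x

/-- The field `ℂ_v`: the completion of the algebraic closure of `K_v`. -/
abbrev ProductFormula.Cv (v : M) : Type _ := (G.closureAbv v).Completion

/-- The canonical map `K → K_v → K_v^alg → ℂ_v`. -/
noncomputable def ProductFormula.toCv (v : M) : K →+* G.Cv v :=
  (UniformSpace.Completion.coeRingHom.comp
      (WithAbs.equiv (G.closureAbv v)).symm.toRingHom).comp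
    ((algebraMap (G.abv v).Completion (AlgebraicClosure (G.abv v).Completion)).comp
      (UniformSpace.Completion.coeRingHom.comp (WithAbs.equiv (G.abv v)).symm.toRingHom))

/-- A choice, for every place `v`, of an embedding `K^alg → ℂ_v` over `K`. -/
structure ProductFormula.Embeddings where
  emb : ∀ v, AlgebraicClosure K →+* G.Cv v
  emb_algebraMap : ∀ v x, emb v (algebraMap K _ x) = G.toCv v x

/-- The image in `ℂ_v` of a finite set of algebraic elements. -/
noncomputable def ProductFormula.Embeddings.image {G : ProductFormula K M} (ι : G.Embeddings)
    (v : M) (S : Finset (AlgebraicClosure K)) : Finset (G.Cv v) :=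
  S.map ⟨ι.emb v, (ι.emb v).injective⟩

/-- The height of a finite set `S` attached to local functions `lam v : ℂ_v → ℝ`:
`(1/#S) ∑_v ∑_{z ∈ S} n_v λ_v(z)`. -/
noncomputable def ProductFormula.height {G : ProductFormula K M} (ι : G.Embeddings)
    (lam : ∀ v, G.Cv v → ℝ) (S : Finset (AlgebraicClosure K)) : ℝ :=
  1 / (S.card : ℝ) * ∑ᶠ v, ∑ z ∈ S, G.weight v * lam v (ι.emb v z)

theorem galoisOrbit_finite (K : Type*) [Field K] (α : AlgebraicClosure K) :
    (MulAction.orbit (AlgebraicClosure K ≃ₐ[K] AlgebraicClosure K) α).Finite := by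
  refine ((minpoly K α).rootSet_finite (AlgebraicClosure K)).subset ?_
  rintro _ ⟨σ, rfl⟩
  rw [Polynomial.mem_rootSet]
  refine ⟨minpoly.ne_zero (Algebra.IsIntegral.isIntegral α), ?_⟩
  change aeval (σ α) (minpoly K α) = 0
  rw [← AlgEquiv.coe_toAlgHom, Polynomial.aeval_algHom_apply, minpoly.aeval, map_zero]

/-- The smallest Galois-stable set containing `α`. -/
noncomputable def galoisOrbit (α : AlgebraicClosure K) : Finset (AlgebraicClosure K) :=
  (galoisOrbit_finite K α).toFinset

def IsGaloisStable (S : Finset (AlgebraicClosure K)) : Prop :=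
  ∀ σ : AlgebraicClosure K ≃ₐ[K] AlgebraicClosure K, ∀ x ∈ S, σ x ∈ S

/-- The Northcott finiteness property with respect to the absolute logarithmic height, which is the
height attached to the local functions `log⁺ |z|_v`. -/
def ProductFormula.Northcott {G : ProductFormula K M} (ι : G.Embeddings) : Prop :=
  ∀ (d : ℕ) (B : ℝ), {α : AlgebraicClosure K | (minpoly K α).natDegree ≤ d ∧
    ProductFormula.height ι (fun _ z => Real.posLog ‖z‖) (galoisOrbit α) ≤ B}.Finite

/-- `F` is an adelic set: `F v` is the closed unit disc of `ℂ_v` for almost all `v`. -/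
def ProductFormula.IsAdelicSet (F : ∀ v, Set (G.Cv v)) : Prop :=
  {v | F v ≠ {z | ‖z‖ ≤ 1}}.Finite

/-- The capacity `∏_v c(F_v)^{n_v}` of an adelic set. -/
noncomputable def ProductFormula.capacity (F : ∀ v, Set (G.Cv v)) : ℝ :=
  ∏ᶠ v, transfiniteDiameter (F v) ^ G.weight v

end Global

end AdelicCapacity

/-! The discriminant of a Galois-stable set of separable elements is a nonzero element of `K`
(`exists_algebraMap_eq_prod_offDiag`), so by the product formula the weighted logarithms of the
local diameters of `S n` sum to zero over all places. The weighted logarithms of the capacities also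
sum to zero. Hence it suffices to bound the local diameters from above, asymptotically, by the
capacities: a deficit at one place would have to be made up elsewhere.

The upper bound at a single place comes from a Vandermonde determinant written in a basis of powers
of the polynomial of a lemniscate (`exists_geometricMean_le`). It involves the mean of the Green's
function of the lemniscate, which is at most `lam` because Green's functions increase along
descending lemniscates (Bernstein–Walsh, `norm_eval_le_norm_eval_pow`). As `lam` is nonnegative,
heights tending to zero force its means to zero at each place. The number of places that matter is
not bounded in `n`, so outside a fixed finite set the contribution is bounded by twice the height,
without error term (`finsetDiameter_le_exp`, `IsGeneralizedGreen.posLog_le`). Northcott makes the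
cardinalities grow.

Archimedean and ultrametric places are treated together: maximum principles are replaced by Cauchy's
estimate, obtained by averaging over roots of unity. -/

namespace AdelicCapacity

/-! ### Cauchy's estimate and products over the fibres of a polynomial -/

/-- For arbitrarily large `m`, the arithmetic mean of `m` elements of a closed ball centred at `0`
is defined and lies in that ball. -/
def HasContractiveMeans (L : Type*) [NormedField L] : Prop :=
  ∀ n : ℕ, ∃ m : ℕ, n < m ∧ (m : L) ≠ 0 ∧ ∀ (f : ℕ → L) (B : ℝ), (∀ i < m, ‖f i‖ ≤ B) →
    ‖∑ i ∈ Finset.range m, f i‖ ≤ ‖(m : L)‖ * B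

section Local

variable {L : Type*} [NormedField L]

theorem sum_pow_primitiveRoot {m : ℕ} {ζ : L} (hζ : IsPrimitiveRoot ζ m) (l : ℕ) :
    ∑ i ∈ Finset.range m, (ζ ^ l) ^ i = if m ∣ l then (m : L) else 0 := by
  split_ifs with h
  · simp [(hζ.pow_eq_one_iff_dvd l).2 h]
  · have h1 : ζ ^ l ≠ 1 := fun h1 => h ((hζ.pow_eq_one_iff_dvd l).1 h1)
    refine eq_zero_of_ne_zero_of_mul_left_eq_zero (sub_ne_zero_of_ne h1.symm) ?_
    rw [mul_neg_geom_sum, ← pow_mul, mul_comm, pow_mul, hζ.pow_eq_one, one_pow, sub_self]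

/-- **Cauchy's estimate** for polynomials, by averaging over roots of unity. -/
theorem exists_norm_coeff_le_norm_eval [IsAlgClosed L] (hL : HasContractiveMeans L) (H : L[X])
    (k : ℕ) : ∃ w : L, ‖w‖ = 1 ∧ ‖H.coeff k‖ ≤ ‖H.eval w‖ := by
  obtain ⟨m, hm, hm0, hmean⟩ := hL (max k H.natDegree)
  have hk : k < m := lt_of_le_of_lt (le_max_left _ _) hm
  have hd : H.natDegree < m := lt_of_le_of_lt (le_max_right _ _) hm
  have : NeZero (m : L) := ⟨hm0⟩
  have : NeZero m := NeZero.of_neZero_natCast L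
  obtain ⟨ζ, hζ⟩ := HasEnoughRootsOfUnity.exists_primitiveRoot L m
  have hn : ‖ζ‖ = 1 := by
    have h : ‖ζ‖ ^ m = 1 := by rw [← norm_pow, hζ.pow_eq_one, norm_one]
    exact (pow_eq_one_iff_of_nonneg (norm_nonneg _) (NeZero.ne m)).1 h
  have key : ∑ i ∈ Finset.range m, H.eval (ζ ^ i) * (ζ ^ i) ^ (m - k) = m * H.coeff k := by
    have h1 : ∀ i ∈ Finset.range m, H.eval (ζ ^ i) * (ζ ^ i) ^ (m - k) =
        ∑ j ∈ Finset.range m, H.coeff j * (ζ ^ (j + (m - k))) ^ i := by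
      intro i _
      rw [Polynomial.eval_eq_sum_range' hd, Finset.sum_mul]
      refine Finset.sum_congr rfl fun j _ => ?_
      rw [mul_assoc, ← pow_add, ← pow_mul, ← pow_mul, mul_comm i]
    rw [Finset.sum_congr rfl h1, Finset.sum_comm]
    simp_rw [← Finset.mul_sum, sum_pow_primitiveRoot hζ]
    rw [Finset.sum_eq_single_of_mem k (Finset.mem_range.2 hk)]
    · rw [if_pos (by simp [Nat.add_sub_cancel' hk.le]), mul_comm]
    · intro j hj hjk
      rw [if_neg, mul_zero]
      rintro ⟨c, hc⟩
      have hj' := Finset.mem_range.1 hj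
      -- Since `0 < j + (m - k) < 2 * m`, the only multiple of `m` available is `m` itself, that is
      -- `j = k`.
      have h3 : c < 2 := by
        by_contra h3
        have : m * 2 ≤ m * c := Nat.mul_le_mul_left _ (by omega)
        omega
      interval_cases c <;> omega
  obtain ⟨i, hi, hmax⟩ := Finset.exists_max_image (Finset.range m)
    (fun i => ‖H.eval (ζ ^ i)‖) ⟨k, Finset.mem_range.2 hk⟩
  refine ⟨ζ ^ i, by simp [hn], ?_⟩
  have h2 := hmean (fun i => H.eval (ζ ^ i) * (ζ ^ i) ^ (m - k)) ‖H.eval (ζ ^ i)‖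
    fun j hj => by simpa [hn] using hmax j (Finset.mem_range.2 hj)
  rw [key, norm_mul] at h2
  exact le_of_mul_le_mul_left h2 (norm_pos_iff.2 hm0)

/-- The product of the values of a polynomial `W` over the fibre `Q = w` is a polynomial in `w`
of degree at most `deg W`. -/
theorem exists_fibre_norm [IsAlgClosed L] (Q W : L[X]) (hQ : 0 < Q.natDegree) :
    ∃ H : L[X], (∀ w, H.eval w = ((Q - C w).roots.map W.eval).prod) ∧
      H.natDegree ≤ W.natDegree ∧
      ‖H.coeff W.natDegree‖ = ‖W.leadingCoeff‖ ^ Q.natDegree / ‖Q.leadingCoeff‖ ^ W.natDegree := by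
  set d := Q.natDegree with hd
  have hcardW : W.roots.card = W.natDegree := ((IsAlgClosed.splits W).natDegree_eq_card_roots).symm
  -- This is the resultant formula: exchanging the products over the fibre and over the roots `b` of
  -- `W` leaves the factors `w - Q(b)`, and `u` collects the leading coefficients and signs.
  set u : L := W.leadingCoeff ^ d * ((-1) ^ (d + 1) * Q.leadingCoeff⁻¹) ^ W.natDegree with hu
  let Mo : L[X] := ((W.roots.map Q.eval).map fun b => X - C b).prod
  have hMmonic : Mo.Monic := monic_multiset_prod_of_monic _ _ fun b _ => monic_X_sub_C b
  have hMdeg : Mo.natDegree = W.natDegree := by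
    rw [natDegree_multiset_prod_X_sub_C_eq_card, Multiset.card_map, hcardW]
  refine ⟨C u * Mo, fun w => ?_, ?_, ?_⟩
  · have hdeg : (Q - C w).natDegree = d := natDegree_sub_C
    have hlc : (Q - C w).leadingCoeff = Q.leadingCoeff := by
      rw [leadingCoeff, hdeg, coeff_sub, coeff_C, if_neg (by omega), sub_zero, hd, leadingCoeff]
    have hcard : (Q - C w).roots.card = d := by
      rw [← (IsAlgClosed.splits (Q - C w)).natDegree_eq_card_roots, hdeg]
    have hq0 : Q.leadingCoeff ≠ 0 := by
      rw [leadingCoeff_ne_zero]; rintro rfl; simp at hd; omega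
    have h1 : (Q - C w).roots.map W.eval = (Q - C w).roots.map fun z =>
        W.leadingCoeff * (W.roots.map (fun b => z - b)).prod :=
      Multiset.map_congr rfl fun z _ => (IsAlgClosed.splits W).eval_eq_prod_roots z
    rw [h1, Multiset.prod_map_mul, Multiset.map_const', Multiset.prod_replicate, hcard,
      Multiset.prod_map_prod_map]
    have h2 : ∀ b, ((Q - C w).roots.map fun z => z - b).prod =
        ((-1) ^ (d + 1) * Q.leadingCoeff⁻¹) * (w - Q.eval b) := by
      intro b
      have h3 := (IsAlgClosed.splits (Q - C w)).eval_eq_prod_roots b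
      have h4 : ((Q - C w).roots.map fun z => z - b) =
          (Q - C w).roots.map fun z => (-1) * (b - z) := Multiset.map_congr rfl fun z _ => by ring
      rw [h4, Multiset.prod_map_mul, Multiset.map_const', Multiset.prod_replicate, hcard]
      rw [hlc, eval_sub, eval_C] at h3
      have h5 : w - Q.eval b = -(Q.leadingCoeff * ((Q - C w).roots.map (b - ·)).prod) := by
        rw [← h3]; ring
      rw [h5]
      field_simp
      ring
    simp_rw [h2]
    rw [Multiset.prod_map_mul, Multiset.map_const', Multiset.prod_replicate, hcardW, eval_mul,
      eval_C, eval_multiset_prod, Multiset.map_map, Multiset.map_map, hu, mul_assoc]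
    simp [Function.comp_def]
  · exact (natDegree_C_mul_le _ _).trans hMdeg.le
  · rw [coeff_C_mul, ← hMdeg, coeff_natDegree, hMmonic.leadingCoeff, mul_one, hMdeg, hu]
    simp [div_eq_mul_inv]

/-! ### Transfinite diameter of a lemniscate -/

/-- The normalisation of the lemniscate `{|P| ≤ R}`, later seen to be its transfinite diameter. -/
noncomputable def lemniscateCapacity (P : L[X]) (R : ℝ) : ℝ :=
  (R / ‖P.leadingCoeff‖) ^ (1 / (P.natDegree : ℝ))

theorem lemniscateCapacity_pos {P : L[X]} {R : ℝ} (hP : 0 < P.natDegree) (hR : 0 < R) :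
    0 < lemniscateCapacity P R := by
  have : 0 < ‖P.leadingCoeff‖ := by
    rw [norm_pos_iff, leadingCoeff_ne_zero]; rintro rfl; simp at hP
  unfold lemniscateCapacity
  positivity

theorem lemniscateCapacity_pow {P : L[X]} {R : ℝ} (hP : 0 < P.natDegree) (hR : 0 < R) :
    lemniscateCapacity P R ^ P.natDegree = R / ‖P.leadingCoeff‖ := by
  rw [lemniscateCapacity, ← Real.rpow_natCast, ← Real.rpow_mul (by positivity), one_div,
    inv_mul_cancel₀ (by positivity), Real.rpow_one]

theorem roots_sub_C_card [IsAlgClosed L] (Q : L[X]) (w : L) :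
    (Q - C w).roots.card = Q.natDegree := by
  rw [← (IsAlgClosed.splits (Q - C w)).natDegree_eq_card_roots, natDegree_sub_C]

theorem eval_of_mem_roots_sub_C {Q : L[X]} {w z : L} (hz : z ∈ (Q - C w).roots) :
    Q.eval z = w := by
  have := (mem_roots'.1 hz).2
  rwa [IsRoot.def, eval_sub, eval_C, sub_eq_zero] at this

theorem norm_multiset_prod_map {ι : Type*} (s : Multiset ι) (f : ι → L) :
    ‖(s.map f).prod‖ = (s.map fun x => ‖f x‖).prod := by
  induction s using Multiset.induction_on with
  | empty => simp
  | cons a s ih => simp [ih]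

theorem multiset_prod_map_le_pow {ι : Type*} (s : Multiset ι) (f : ι → ℝ) (B : ℝ)
    (h0 : ∀ x ∈ s, 0 ≤ f x) (h : ∀ x ∈ s, f x ≤ B) : (s.map f).prod ≤ B ^ s.card := by
  have := Multiset.prod_map_le_prod_map₀ f (fun _ => B) h0 h
  simpa using this

/-- A monic polynomial of degree `n` takes on a lemniscate of capacity `c` a value of norm at
least `c ^ n`. -/
theorem exists_mem_lemniscate_pow_le [IsAlgClosed L] (hL : HasContractiveMeans L) {Q : L[X]}
    (hQ : 0 < Q.natDegree) {a : L} (ha : a ≠ 0) {f : L[X]} (hf : f.Monic) :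
    ∃ z ∈ lemniscate Q ‖a‖, lemniscateCapacity Q ‖a‖ ^ f.natDegree ≤ ‖f.eval z‖ := by
  have ha' : 0 < ‖a‖ := norm_pos_iff.2 ha
  obtain ⟨H, hH, -, hlead⟩ := exists_fibre_norm Q f hQ
  -- The coefficient of `H(aX)` in degree `deg f` has norm `c ^ (deg Q * deg f)`. The value it is
  -- compared with is a product of `deg Q` values of `f` on the lemniscate, so the largest of them
  -- is big enough.
  obtain ⟨w, hw, hle⟩ := exists_norm_coeff_le_norm_eval hL (H.comp (C a * X)) f.natDegree
  rw [comp_C_mul_X_coeff, norm_mul, hlead, hf.leadingCoeff, norm_one, one_pow, norm_pow, eval_comp,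
    hH, eval_mul, eval_C, eval_X, norm_multiset_prod_map] at hle
  set s := (Q - C (a * w)).roots with hs
  have hcard : s.card = Q.natDegree := roots_sub_C_card _ _
  have hne : s ≠ 0 := by rintro h; rw [h] at hcard; simp at hcard; omega
  classical
  obtain ⟨z, hz, hmax⟩ := Finset.exists_max_image s.toFinset (fun z => ‖f.eval z‖)
    (by simpa using Multiset.toFinset_nonempty.2 hne)
  rw [Multiset.mem_toFinset] at hz
  refine ⟨z, ?_, ?_⟩
  · rw [lemniscate, Set.mem_ofPred_eq, eval_of_mem_roots_sub_C hz, norm_mul, hw, mul_one]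
  · have h1 := multiset_prod_map_le_pow s (fun z => ‖f.eval z‖) ‖f.eval z‖
      (fun _ _ => norm_nonneg _) (fun x hx => hmax x (Multiset.mem_toFinset.2 hx))
    rw [hcard] at h1
    refine le_of_pow_le_pow_left₀ hQ.ne' (norm_nonneg _) (le_trans (le_of_eq ?_) (hle.trans h1))
    rw [← pow_mul, mul_comm, pow_mul, lemniscateCapacity_pow hQ ha', div_pow]
    ring

theorem lemniscateGreen_nonneg (P : L[X]) (R : ℝ) (z : L) : 0 ≤ lemniscateGreen P R z :=
  mul_nonneg (by positivity) Real.posLog_nonneg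

theorem lemniscateGreen_eq_zero {P : L[X]} {R : ℝ} (hR : 0 < R) {z : L}
    (hz : z ∈ lemniscate P R) : lemniscateGreen P R z = 0 := by
  rw [lemniscateGreen, (Real.posLog_eq_zero_iff _).2, mul_zero]
  rw [abs_of_nonneg (by positivity)]
  exact (div_le_one hR).2 hz

theorem le_exp_lemniscateGreen_pow {P : L[X]} (hP : 0 < P.natDegree) {R : ℝ} (hR : 0 < R)
    (z : L) : ‖P.eval z‖ / R ≤ Real.exp (lemniscateGreen P R z) ^ P.natDegree := by
  rw [← Real.exp_nat_mul, lemniscateGreen, ← mul_assoc, mul_one_div_cancel (by positivity),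
    one_mul, Real.posLog_eq_log_max_one (by positivity), Real.exp_log (by positivity)]
  exact le_max_right _ _

/-- Green's function of a lemniscate grows at least like `log |z|`. -/
theorem exists_norm_le_mul_exp_lemniscateGreen [IsAlgClosed L] {Q : L[X]} (hQ : 0 < Q.natDegree)
    {R : ℝ} (hR : 0 < R) :
    ∃ C : ℝ, 0 < C ∧ ∀ z, ‖z‖ ≤ C * Real.exp (lemniscateGreen Q R z) := by
  obtain ⟨A, hA0, hA⟩ : ∃ A : ℝ, 0 ≤ A ∧ ∀ b ∈ Q.roots, ‖b‖ ≤ A := by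
    classical
    refine ⟨∑ b ∈ Q.roots.toFinset, ‖b‖, Finset.sum_nonneg fun _ _ => norm_nonneg _,
      fun b hb => ?_⟩
    exact Finset.single_le_sum (f := fun b => ‖b‖) (fun _ _ => norm_nonneg _)
      (Multiset.mem_toFinset.2 hb)
  have hc := lemniscateCapacity_pos hQ hR
  -- The first entry covers `‖z‖ ≤ 2 * A + 1`. Beyond that, `z` is at distance at least `‖z‖ / 2`
  -- from every root, and the factor 2 in the second entry compensates for this.
  refine ⟨max (2 * A + 1) (2 * lemniscateCapacity Q R), by positivity, fun z => ?_⟩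
  rcases le_or_gt ‖z‖ (2 * A + 1) with h | h
  · calc ‖z‖ ≤ (2 * A + 1) * 1 := by linarith
      _ ≤ _ := mul_le_mul (le_max_left _ _) (Real.one_le_exp (lemniscateGreen_nonneg _ _ _))
        zero_le_one (by positivity)
  · refine le_trans ?_ (mul_le_mul_of_nonneg_right (le_max_right _ _) (Real.exp_pos _).le)
    refine le_of_pow_le_pow_left₀ hQ.ne' (by positivity) ?_
    have h1 := le_exp_lemniscateGreen_pow hQ hR z
    have hlc : 0 < ‖Q.leadingCoeff‖ := by
      rw [norm_pos_iff, leadingCoeff_ne_zero]; rintro rfl; simp at hQ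
    have h2 : ‖Q.leadingCoeff‖ * (‖z‖ / 2) ^ Q.natDegree ≤ ‖Q.eval z‖ := by
      rw [(IsAlgClosed.splits Q).eval_eq_prod_roots z, norm_mul, norm_multiset_prod_map]
      refine mul_le_mul_of_nonneg_left ?_ (norm_nonneg _)
      rw [(IsAlgClosed.splits Q).natDegree_eq_card_roots]
      have := Multiset.prod_map_le_prod_map₀ (s := Q.roots) (fun _ => ‖z‖ / 2) (fun b => ‖z - b‖)
        (fun _ _ => by positivity) (fun b hb => by
          have h3 := hA b hb
          have h4 := norm_sub_norm_le z b
          linarith)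
      simpa using this
    rw [mul_pow, mul_pow, lemniscateCapacity_pow hQ hR]
    calc ‖z‖ ^ Q.natDegree = 2 ^ Q.natDegree * (R / ‖Q.leadingCoeff‖) *
          (‖Q.leadingCoeff‖ * (‖z‖ / 2) ^ Q.natDegree / R) := by
          field_simp
          rw [← mul_pow]
          congr 1
          ring
      _ ≤ 2 ^ Q.natDegree * (R / ‖Q.leadingCoeff‖) * (‖Q.eval z‖ / R) := by gcongr
      _ ≤ _ := by gcongr

/-- Leibniz expansion suffices in place of Hadamard's inequality: the factorial disappears after
taking the root of order `N * (N - 1)`. -/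
theorem norm_det_le {n : Type*} [Fintype n] [DecidableEq n] (A : Matrix n n L) (α β : n → ℝ)
    (h : ∀ i j, ‖A i j‖ ≤ β i * α j) :
    ‖A.det‖ ≤ (Fintype.card n).factorial * ((∏ i, β i) * ∏ i, α i) := by
  rw [Matrix.det_apply]
  refine (norm_sum_le_of_le (f := fun σ : Equiv.Perm n => Equiv.Perm.sign σ • ∏ i, A (σ i) i) _
    (n := fun _ => (∏ i, β i) * ∏ i, α i) ?_).trans ?_
  · intro σ _
    have h1 : ‖Equiv.Perm.sign σ • ∏ i, A (σ i) i‖ = ∏ i, ‖A (σ i) i‖ := by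
      rcases Int.units_eq_one_or (Equiv.Perm.sign σ) with h | h <;> simp [h, norm_prod]
    rw [h1, ← Equiv.prod_comp σ β, ← Finset.prod_mul_distrib]
    exact Finset.prod_le_prod (fun _ _ => norm_nonneg _) fun i _ => h _ _
  · simp [Fintype.card_perm]

theorem prod_offDiag_univ_eq_sq {N : ℕ} (g : Fin N → Fin N → ℝ) (hg : ∀ i j, g i j = g j i) :
    ∏ p ∈ (Finset.univ : Finset (Fin N)).offDiag, g p.1 p.2 =
      (∏ i, ∏ j ∈ Finset.Ioi i, g i j) ^ 2 := by
  have h1 : (Finset.univ : Finset (Fin N)).offDiag =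
      (Finset.univ.sigma fun i : Fin N => Finset.Ioi i).image (fun p => (p.1, p.2)) ∪
      (Finset.univ.sigma fun i : Fin N => Finset.Ioi i).image (fun p => (p.2, p.1)) := by
    ext ⟨i, j⟩
    simp only [Finset.mem_offDiag, Finset.mem_univ, true_and, Finset.mem_union, Finset.mem_image,
      Finset.mem_sigma, Finset.mem_Ioi, Sigma.exists, Prod.mk.injEq]
    constructor
    · intro h
      rcases lt_or_gt_of_ne h with h | h
      · exact Or.inl ⟨i, j, h, rfl, rfl⟩
      · exact Or.inr ⟨j, i, h, rfl, rfl⟩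
    · rintro (⟨a, b, h, rfl, rfl⟩ | ⟨a, b, h, rfl, rfl⟩)
      · exact h.ne
      · exact h.ne'
  rw [h1, Finset.prod_union, Finset.prod_image, Finset.prod_image, sq, Finset.prod_sigma,
    Finset.prod_sigma]
  · congr 1
    exact Finset.prod_congr rfl fun i _ => Finset.prod_congr rfl fun j _ => hg _ _
  · rintro ⟨a, b⟩ - ⟨c, d⟩ - h
    simp only [Prod.mk.injEq] at h
    obtain ⟨rfl, rfl⟩ := h; rfl
  · rintro ⟨a, b⟩ - ⟨c, d⟩ - h
    simp only [Prod.mk.injEq] at h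
    obtain ⟨rfl, rfl⟩ := h; rfl
  · rw [Finset.disjoint_left]
    rintro ⟨i, j⟩ h h'
    simp only [Finset.mem_univ, true_and, Finset.mem_image,
      Finset.mem_sigma, Finset.mem_Ioi, Sigma.exists, Prod.mk.injEq] at h h'
    obtain ⟨a, b, h, rfl, rfl⟩ := h
    obtain ⟨c, d, h', rfl, rfl⟩ := h'
    exact lt_asymm h h'

/-- Upper bound for Vandermonde products in terms of the Green's function of a lemniscate. -/
theorem exists_prod_offDiag_dist_le [IsAlgClosed L] {Q : L[X]} (hQ : 0 < Q.natDegree)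
    {R : ℝ} (hR : 0 < R) :
    ∃ C : ℝ, 1 ≤ C ∧ ∀ (N : ℕ) (x : Fin N → L),
      ∏ p ∈ (Finset.univ : Finset (Fin N)).offDiag, dist (x p.1) (x p.2) ≤
        (N.factorial * C ^ N * Real.exp (∑ i, lemniscateGreen Q R (x i)) ^ (N - 1)) ^ 2 *
          lemniscateCapacity Q R ^ (N * (N - 1)) := by
  obtain ⟨C₀, hC₀, hgrow⟩ := exists_norm_le_mul_exp_lemniscateGreen hQ hR
  set c := lemniscateCapacity Q R with hc
  set d := Q.natDegree with hd
  have hc0 : 0 < c := lemniscateCapacity_pos hQ hR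
  have hlc : Q.leadingCoeff ≠ 0 := by
    rw [leadingCoeff_ne_zero]; rintro rfl; simp at hd; omega
  let q : L[X] := C Q.leadingCoeff⁻¹ * Q
  have hq : q.Monic := monic_C_mul_of_mul_leadingCoeff_eq_one (inv_mul_cancel₀ hlc)
  have hqd : q.natDegree = d := natDegree_C_mul (inv_ne_zero hlc)
  -- Monic polynomials of degrees `0, 1, 2, …` leave the Vandermonde determinant unchanged. Powers
  -- of `q` make them as small as the capacity allows, up to the constant `D` that absorbs the
  -- remainder `k % d`.
  let b : ℕ → L[X] := fun k => X ^ (k % d) * q ^ (k / d)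
  have hbm : ∀ k, (b k).Monic := fun k => (monic_X_pow _).mul (hq.pow _)
  have hbd : ∀ k, (b k).natDegree = k := fun k => by
    rw [(monic_X_pow _).natDegree_mul (hq.pow _), natDegree_X_pow, hq.natDegree_pow, hqd,
      mul_comm]
    exact Nat.mod_add_div k d
  set D : ℝ := max 1 (C₀ / c) ^ d with hD
  have hD1 : 1 ≤ D := one_le_pow₀ (le_max_left _ _)
  refine ⟨D, hD1, fun N x => ?_⟩
  set E : L → ℝ := fun z => Real.exp (lemniscateGreen Q R z) with hE
  have hE1 : ∀ z, 1 ≤ E z := fun z => Real.one_le_exp (lemniscateGreen_nonneg _ _ _)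
  have hbb : ∀ k z, ‖(b k).eval z‖ ≤ D * (c * E z) ^ k := by
    intro k z
    have hcE : 0 < c * E z := mul_pos hc0 (Real.exp_pos _)
    have h1 : ‖z‖ ≤ max 1 (C₀ / c) * (c * E z) := by
      refine (hgrow z).trans ?_
      calc C₀ * E z = C₀ / c * (c * E z) := by field_simp
        _ ≤ _ := by gcongr; exact le_max_right _ _
    have h2 : ‖q.eval z‖ ≤ (c * E z) ^ d := by
      rw [mul_pow, hc, hd, lemniscateCapacity_pow hQ hR]
      have h3 := le_exp_lemniscateGreen_pow hQ hR z
      have h4 : 0 < ‖Q.leadingCoeff‖ := norm_pos_iff.2 hlc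
      simp only [q, eval_mul, eval_C, norm_mul, norm_inv]
      calc ‖Q.leadingCoeff‖⁻¹ * ‖Q.eval z‖ = R / ‖Q.leadingCoeff‖ * (‖Q.eval z‖ / R) := by
            field_simp
        _ ≤ _ := by gcongr
    calc ‖(b k).eval z‖ = ‖z‖ ^ (k % d) * ‖q.eval z‖ ^ (k / d) := by simp [b]
      _ ≤ (max 1 (C₀ / c) * (c * E z)) ^ (k % d) * ((c * E z) ^ d) ^ (k / d) := by gcongr
      _ = max 1 (C₀ / c) ^ (k % d) * (c * E z) ^ (k % d + d * (k / d)) := by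
        rw [mul_pow, pow_add, pow_mul, mul_assoc]
      _ ≤ D * (c * E z) ^ k := by
        rw [Nat.mod_add_div]
        have h7 : max 1 (C₀ / c) ^ (k % d) ≤ D :=
          pow_le_pow_right₀ (le_max_left _ _) (Nat.mod_lt k hQ).le
        exact mul_le_mul_of_nonneg_right h7 (by positivity)
  -- The entry bound splits into a column factor and a row factor; since `E ≥ 1`, the exponent `j`
  -- of `E` can be raised to `N - 1`.
  have hdet := norm_det_le (Matrix.of fun i j : Fin N => (b j).eval (x i))
    (fun j => D * c ^ (j : ℕ)) (fun i => E (x i) ^ (N - 1)) (fun i j => by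
      refine (hbb j (x i)).trans ?_
      rw [mul_pow]
      have : E (x i) ^ (j : ℕ) ≤ E (x i) ^ (N - 1) := pow_le_pow_right₀ (hE1 _) (by omega)
      calc D * (c ^ (j : ℕ) * E (x i) ^ (j : ℕ)) = D * c ^ (j : ℕ) * E (x i) ^ (j : ℕ) := by ring
        _ ≤ D * c ^ (j : ℕ) * E (x i) ^ (N - 1) := by gcongr
        _ = _ := by ring)
  rw [← Matrix.det_eval_matrixOfPolynomials_eq_det_vandermonde x (fun j => b j) (fun j => hbd j)
    (fun j => hbm j), Matrix.det_vandermonde] at hdet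
  rw [prod_offDiag_univ_eq_sq (fun i j => dist (x i) (x j)) (fun _ _ => dist_comm _ _)]
  have h5 : ∏ i, ∏ j ∈ Finset.Ioi i, dist (x i) (x j) =
      ‖∏ i, ∏ j ∈ Finset.Ioi i, (x j - x i)‖ := by
    rw [norm_prod]
    refine Finset.prod_congr rfl fun i _ => ?_
    rw [norm_prod]
    exact Finset.prod_congr rfl fun j _ => by rw [dist_comm, dist_eq_norm]
  rw [h5]
  refine (pow_le_pow_left₀ (norm_nonneg _) hdet 2).trans (le_of_eq ?_)
  have h6 : ∏ i : Fin N, c ^ (i : ℕ) = c ^ (∑ i ∈ Finset.range N, i) := by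
    rw [← Finset.prod_pow_eq_pow_sum, Fin.prod_univ_eq_prod_range (fun i => c ^ i)]
  rw [Finset.prod_pow, Finset.prod_mul_distrib, h6, ← Finset.sum_range_id_mul_two, pow_mul,
    Real.exp_sum]
  simp
  ring

theorem rpow_le_of_le_pow {N : ℕ} (hN : 2 ≤ N) {a b : ℝ} (ha : 0 ≤ a) (hb : 0 ≤ b)
    (h : a ≤ b ^ (N * (N - 1))) : a ^ (1 / ((N : ℝ) * ((N : ℝ) - 1))) ≤ b := by
  have h1 : ((N * (N - 1) : ℕ) : ℝ) = (N : ℝ) * ((N : ℝ) - 1) := by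
    rw [Nat.cast_mul, Nat.cast_sub (by omega), Nat.cast_one]
  have h0 : N * (N - 1) ≠ 0 := Nat.mul_ne_zero (by omega) (by omega)
  rw [← h1, one_div]
  calc a ^ (((N * (N - 1) : ℕ) : ℝ)⁻¹) ≤ (b ^ (N * (N - 1))) ^ (((N * (N - 1) : ℕ) : ℝ)⁻¹) :=
        Real.rpow_le_rpow ha h (by positivity)
    _ = b := Real.pow_rpow_inv_natCast hb h0

theorem le_rpow_of_pow_le {N : ℕ} (hN : 2 ≤ N) {a b : ℝ} (hb : 0 ≤ b)
    (h : b ^ (N * (N - 1)) ≤ a) : b ≤ a ^ (1 / ((N : ℝ) * ((N : ℝ) - 1))) := by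
  have h0 : N * (N - 1) ≠ 0 := Nat.mul_ne_zero (by omega) (by omega)
  have h1 : ((N * (N - 1) : ℕ) : ℝ) = (N : ℝ) * ((N : ℝ) - 1) := by
    rw [Nat.cast_mul, Nat.cast_sub (by omega), Nat.cast_one]
  rw [← h1, one_div]
  calc b = (b ^ (N * (N - 1))) ^ (((N * (N - 1) : ℕ) : ℝ)⁻¹) := by
        rw [Real.pow_rpow_inv_natCast hb h0]
    _ ≤ _ := Real.rpow_le_rpow (by positivity) h (by positivity)

/-- After the root is taken, the squared `(N - 1)`-th power of the exponential becomes exactly twice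
the mean of the Green's function. Using `N! ≤ N ^ N`, the other factors leave `2 * (log N + log C) /
(N - 1)`, which does not depend on the points. -/
theorem exists_geometricMean_le [IsAlgClosed L] {Q : L[X]} (hQ : 0 < Q.natDegree)
    {R : ℝ} (hR : 0 < R) :
    ∃ err : ℕ → ℝ, Tendsto err atTop (𝓝 0) ∧ ∀ (N : ℕ), 2 ≤ N → ∀ (x : Fin N → L),
      (∏ p ∈ (Finset.univ : Finset (Fin N)).offDiag, dist (x p.1) (x p.2)) ^
        (1 / ((N : ℝ) * ((N : ℝ) - 1))) ≤
      lemniscateCapacity Q R *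
        Real.exp (err N + 2 * (1 / (N : ℝ) * ∑ i, lemniscateGreen Q R (x i))) := by
  obtain ⟨C, hC, hb⟩ := exists_prod_offDiag_dist_le hQ hR
  have hc0 := lemniscateCapacity_pos hQ hR
  refine ⟨fun N => 2 * (Real.log N + Real.log C) / ((N : ℝ) - 1), ?_, fun N hN x => ?_⟩
  · have h1 : Tendsto (fun N : ℕ => Real.log N / ((N : ℝ) + (-1))) atTop (𝓝 0) := by
      have := Real.tendsto_pow_log_div_mul_add_atTop 1 (-1) 1 one_ne_zero
      simpa [Function.comp_def] using this.comp tendsto_natCast_atTop_atTop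
    have h2 : Tendsto (fun N : ℕ => (N : ℝ) + (-1)) atTop atTop :=
      tendsto_atTop_add_const_right _ _ tendsto_natCast_atTop_atTop
    have h3 := (h1.const_mul 2).add ((h2.const_div_atTop (Real.log C)).const_mul 2)
    simp only [mul_zero, add_zero] at h3
    refine h3.congr fun N => ?_
    rw [← sub_eq_add_neg]
    ring
  · refine rpow_le_of_le_pow hN (Finset.prod_nonneg fun _ _ => dist_nonneg) (by positivity)
      ((hb N x).trans ?_)
    rw [mul_pow (lemniscateCapacity Q R), mul_comm (lemniscateCapacity Q R ^ _)]
    refine mul_le_mul_of_nonneg_right ?_ (by positivity)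
    have hN0 : (0 : ℝ) < N := by positivity
    have hN1 : (0 : ℝ) < (N : ℝ) - 1 := by
      have : (2 : ℝ) ≤ N := by exact_mod_cast hN
      linarith
    have hf : (N.factorial : ℝ) ≤ Real.exp (N * Real.log N) := by
      rw [Real.exp_nat_mul, Real.exp_log hN0]
      exact_mod_cast Nat.factorial_le_pow N
    have hCN : C ^ N = Real.exp (N * Real.log C) := by
      rw [Real.exp_nat_mul, Real.exp_log (by linarith)]
    calc _ ≤ (Real.exp (N * Real.log N) * Real.exp (N * Real.log C) *
          Real.exp (∑ i, lemniscateGreen Q R (x i)) ^ (N - 1)) ^ 2 := by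
          rw [hCN]; gcongr
      _ = _ := by
        rw [← Real.exp_nat_mul, ← Real.exp_add, ← Real.exp_add, ← Real.exp_nat_mul,
          ← Real.exp_nat_mul]
        congr 1
        rw [Nat.cast_mul, Nat.cast_sub (by omega)]
        push_cast
        field_simp

/-- Points are chosen one at a time in the manner of Leja: the next point is one where the monic
polynomial vanishing at the earlier ones is large. -/
theorem exists_fekete_tuple [IsAlgClosed L] (hL : HasContractiveMeans L) {Q : L[X]}
    (hQ : 0 < Q.natDegree) {a : L} (ha : a ≠ 0) (N : ℕ) :
    ∃ x : ℕ → L, ∀ n < N, x n ∈ lemniscate Q ‖a‖ ∧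
      lemniscateCapacity Q ‖a‖ ^ n ≤ ∏ i ∈ Finset.range n, dist (x n) (x i) := by
  induction N with
  | zero => exact ⟨0, fun n hn => by omega⟩
  | succ N ih =>
    obtain ⟨x, hx⟩ := ih
    obtain ⟨z, hz, hle⟩ := exists_mem_lemniscate_pow_le hL hQ ha
      (monic_prod_of_monic (Finset.range N) (fun i => X - C (x i)) fun i _ => monic_X_sub_C _)
    rw [natDegree_prod_of_monic _ _ fun i _ => monic_X_sub_C _, eval_prod, norm_prod] at hle
    simp only [natDegree_X_sub_C, Finset.sum_const, Finset.card_range, smul_eq_mul, mul_one,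
      eval_sub, eval_X, eval_C, ← dist_eq_norm] at hle
    refine ⟨Function.update x N z, fun n hn => ?_⟩
    have hlt : ∀ i ∈ Finset.range n, Function.update x N z i = x i := fun i hi => by
      rw [Function.update_of_ne]
      have := Finset.mem_range.1 hi
      omega
    rw [Finset.prod_congr rfl fun i hi => by rw [hlt i hi]]
    rcases Nat.lt_succ_iff_lt_or_eq.1 hn with h | rfl
    · rw [Function.update_of_ne h.ne]
      exact hx n h
    · rw [Function.update_self]
      exact ⟨hz, hle⟩

theorem lemniscateCapacity_le_nthDiameter [IsAlgClosed L] (hL : HasContractiveMeans L) {Q : L[X]}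
    (hQ : 0 < Q.natDegree) {a : L} (ha : a ≠ 0) {N : ℕ} (hN : 2 ≤ N) :
    lemniscateCapacity Q ‖a‖ ≤ nthDiameter (lemniscate Q ‖a‖) N := by
  have ha' : 0 < ‖a‖ := norm_pos_iff.2 ha
  have hc0 := lemniscateCapacity_pos hQ ha'
  obtain ⟨x, hx⟩ := exists_fekete_tuple hL hQ ha N
  obtain ⟨err, -, hb⟩ := exists_geometricMean_le hQ ha'
  refine le_trans ?_ (le_ciSup (f := fun x : Fin N → lemniscate Q ‖a‖ =>
    (∏ p ∈ (Finset.univ : Finset (Fin N)).offDiag, dist (x p.1) (x p.2)) ^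
      (1 / ((N : ℝ) * ((N : ℝ) - 1)))) ?_ (fun i => ⟨x i, (hx i i.2).1⟩))
  · refine le_rpow_of_pow_le hN hc0.le ?_
    simp only [Subtype.dist_eq]
    rw [prod_offDiag_univ_eq_sq (fun i j : Fin N => dist (x i) (x j)) (fun _ _ => dist_comm _ _),
      Finset.prod_comm' (t' := Finset.univ) (s' := fun j => Finset.Iio j) (by simp),
      ← Finset.sum_range_id_mul_two, pow_mul]
    gcongr
    rw [← Finset.prod_pow_eq_pow_sum, ← Fin.prod_univ_eq_prod_range]
    refine Finset.prod_le_prod (fun _ _ => by positivity) fun j _ => ((hx j j.2).2.trans_eq ?_)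
    have h1 := Finset.prod_map (Finset.Iio j) Fin.valEmbedding (fun i => dist (x i) (x j))
    rw [Fin.map_valEmbedding_Iio, Nat.Iio_eq_range] at h1
    refine Eq.trans (Finset.prod_congr rfl fun i _ => dist_comm _ _) h1
  -- A real supremum dominates its terms only for bounded families; the Vandermonde bound supplies
  -- the boundedness.
  · refine ⟨lemniscateCapacity Q ‖a‖ * Real.exp (err N), ?_⟩
    rintro _ ⟨y, rfl⟩
    refine (hb N hN fun i => y i).trans_eq ?_
    rw [Finset.sum_eq_zero fun i _ => lemniscateGreen_eq_zero ha' (y i).2]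
    simp

/-- The Green's function vanishes on the lemniscate, so the Vandermonde upper bound meets the lower
bound from Leja points. The squeeze also proves that the limit exists, which `limUnder` does not
guarantee. -/
theorem transfiniteDiameter_lemniscate [IsAlgClosed L] (hL : HasContractiveMeans L) {Q : L[X]}
    (hQ : 0 < Q.natDegree) {a : L} (ha : a ≠ 0) :
    transfiniteDiameter (lemniscate Q ‖a‖) = lemniscateCapacity Q ‖a‖ := by
  have ha' : 0 < ‖a‖ := norm_pos_iff.2 ha
  obtain ⟨err, herr, hb⟩ := exists_geometricMean_le hQ ha'
  refine Tendsto.limUnder_eq ?_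
  have hup : Tendsto (fun N => lemniscateCapacity Q ‖a‖ * Real.exp (err N)) atTop
      (𝓝 (lemniscateCapacity Q ‖a‖)) := by
    simpa using (Real.continuous_exp.continuousAt.tendsto.comp herr).const_mul
      (lemniscateCapacity Q ‖a‖)
  refine tendsto_of_tendsto_of_tendsto_of_le_of_le' tendsto_const_nhds hup ?_ ?_
  · filter_upwards [eventually_ge_atTop 2] with N hN
    exact lemniscateCapacity_le_nthDiameter hL hQ ha hN
  · filter_upwards [eventually_ge_atTop 2] with N hN
    have := lemniscateCapacity_pos hQ ha'
    refine Real.iSup_le (fun y => ?_) (by positivity)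
    refine (hb N hN fun i => y i).trans_eq ?_
    rw [Finset.sum_eq_zero fun i _ => lemniscateGreen_eq_zero ha' (y i).2]
    simp

/-! ### The Bernstein–Walsh inequality and monotonicity of Green's functions -/

theorem norm_root_le_of_norm_coeff_le {A : L[X]} (hA : A.Monic) (hd : 0 < A.natDegree) {B : ℝ}
    (hB : ∀ j, ‖A.coeff j‖ ≤ B) {r : L} (hr : A.eval r = 0) :
    ‖r‖ ≤ max 1 (A.natDegree * B) := by
  rcases le_or_gt ‖r‖ 1 with h | h
  · exact h.trans (le_max_left _ _)
  · refine le_trans ?_ (le_max_right _ _)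
    have hB0 : 0 ≤ B := (norm_nonneg _).trans (hB 0)
    obtain ⟨e, he⟩ := Nat.exists_eq_succ_of_ne_zero hd.ne'
    rw [eval_eq_sum_range, Finset.sum_range_succ, coeff_natDegree, hA.leadingCoeff, one_mul,
      add_comm] at hr
    have h1 : ‖r‖ ^ A.natDegree ≤ A.natDegree * (B * ‖r‖ ^ e) := by
      rw [← norm_pow, eq_neg_of_add_eq_zero_left hr, norm_neg]
      refine (norm_sum_le_of_le (n := fun _ => B * ‖r‖ ^ e) _ fun j hj => ?_).trans (by simp)
      rw [norm_mul, norm_pow]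
      have hj' := Finset.mem_range.1 hj
      exact mul_le_mul (hB j) (pow_le_pow_right₀ h.le (by omega)) (by positivity) hB0
    rw [he, pow_succ, ← he] at h1
    have h2 : 0 < ‖r‖ ^ e := by positivity
    nlinarith

/-- Closes the power trick of the Bernstein–Walsh inequality: a bound losing only a linear factor in
the exponent loses nothing in the limit. -/
theorem le_one_of_pow_le_linear {x α β : ℝ} (h : ∀ k : ℕ, x ^ k ≤ α * k + β) : x ≤ 1 := by
  by_contra! hx
  have h1 := tendsto_pow_const_div_const_pow_of_one_lt 1 hx
  have h0 := tendsto_pow_const_div_const_pow_of_one_lt 0 hx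
  have h2 := (h1.const_mul α).add (h0.const_mul β)
  simp only [pow_one, pow_zero, mul_zero, add_zero] at h2
  obtain ⟨k, hk⟩ := (h2.eventually_lt_const zero_lt_one).exists
  have hxk : 0 < x ^ k := by positivity
  have h3 := h k
  have h4 : α * (k / x ^ k) + β * (1 / x ^ k) = (α * k + β) / x ^ k := by ring
  rw [h4, div_lt_one hxk] at hk
  linarith

/-- The **Bernstein–Walsh inequality** for a lemniscate of radius one. -/
theorem norm_eval_le_norm_eval_pow [IsAlgClosed L] (hL : HasContractiveMeans L) {P Q : L[X]}
    (hQ : 0 < Q.natDegree) {m : ℕ} (hm : P.natDegree ≤ m * Q.natDegree)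
    (h : ∀ z, ‖Q.eval z‖ ≤ 1 → ‖P.eval z‖ ≤ 1) {z : L} (hz : 1 ≤ ‖Q.eval z‖) :
    ‖P.eval z‖ ≤ ‖Q.eval z‖ ^ m := by
  set d := Q.natDegree with hd
  set w := Q.eval z with hw
  have hw0 : w ≠ 0 := by intro h0; rw [h0, norm_zero] at hz; linarith
  have hwm : 0 < ‖w‖ ^ m := by positivity
  have hzroot : z ∈ (Q - C w).roots := by
    rw [mem_roots', IsRoot.def, eval_sub, eval_C, hw, sub_self]
    refine ⟨fun h0 => ?_, rfl⟩
    have h1 : (Q - C w).natDegree = d := natDegree_sub_C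
    rw [hw, h0, natDegree_zero] at h1
    omega
  suffices key : ∀ k : ℕ, (‖P.eval z‖ / ‖w‖ ^ m) ^ k ≤ (d * (m * d) * 2 ^ d) * k + d * 2 ^ d by
    exact (div_le_one hwm).1 (le_one_of_pow_le_linear key)
  intro k
  -- The conjugates of `P(z) ^ k / w ^ (k * m)` over the fibre of `Q` above `w` are the roots of
  -- `A`. Bounding its coefficients linearly in `k` bounds each root without separating the points
  -- of the fibre.
  let A : L[X] := ((Q - C w).roots.map fun ζ => X - C (P.eval ζ ^ k / w ^ (k * m))).prod
  have hAm : A.Monic := monic_multiset_prod_of_monic _ _ fun b _ => monic_X_sub_C _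
  have hAd : A.natDegree = d := by
    have := natDegree_multiset_prod_X_sub_C_eq_card
      ((Q - C w).roots.map fun ζ => P.eval ζ ^ k / w ^ (k * m))
    rw [Multiset.map_map, Multiset.card_map, roots_sub_C_card] at this
    exact this
  have hAs : ∀ s : L, ‖A.eval s‖ ≤ (k * (m * d) + 1) * (‖s‖ + 1) ^ d := by
    intro s
    -- The product of `W` over the fibres of `Q` is a polynomial `H`, small on the unit circle,
    -- where `‖Q‖ = 1` gives `‖P‖ ≤ 1`. Cauchy's estimate carries this to `w`, where `H` is a power
    -- of `w` times `A(s)`.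
    set W : L[X] := C s * Q ^ (k * m) - P ^ k with hW
    have hWd : W.natDegree ≤ k * (m * d) := by
      refine (natDegree_sub_le _ _).trans (max_le ?_ ?_)
      · refine (natDegree_C_mul_le _ _).trans (natDegree_pow_le.trans ?_)
        rw [mul_assoc]
      · exact natDegree_pow_le.trans (Nat.mul_le_mul_left _ hm)
    obtain ⟨H, hH, hHd, -⟩ := exists_fibre_norm Q W hQ
    have hHc : ∀ j, ‖H.coeff j‖ ≤ (‖s‖ + 1) ^ d := by
      intro j
      obtain ⟨v, hv, hle⟩ := exists_norm_coeff_le_norm_eval hL H j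
      refine hle.trans ?_
      rw [hH, norm_multiset_prod_map, hd, ← roots_sub_C_card Q v]
      refine multiset_prod_map_le_pow _ _ _ (fun _ _ => norm_nonneg _) fun ζ hζ => ?_
      have hQζ := eval_of_mem_roots_sub_C hζ
      have hP := h ζ (by rw [hQζ, hv])
      rw [hW, eval_sub, eval_mul, eval_C, eval_pow, eval_pow, hQζ]
      refine (norm_sub_le _ _).trans (add_le_add ?_ ?_)
      · rw [norm_mul, norm_pow, hv, one_pow, mul_one]
      · rw [norm_pow]
        exact pow_le_one₀ (norm_nonneg _) hP
    have hHw : ‖H.eval w‖ ≤ (k * (m * d) + 1) * ((‖s‖ + 1) ^ d * ‖w‖ ^ (k * (m * d))) := by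
      rw [eval_eq_sum_range' (Nat.lt_succ_of_le (hHd.trans hWd))]
      refine (norm_sum_le_of_le (n := fun _ => (‖s‖ + 1) ^ d * ‖w‖ ^ (k * (m * d))) _
        fun j hj => ?_).trans (by simp)
      rw [norm_mul, norm_pow]
      have hj' := Finset.mem_range.1 hj
      exact mul_le_mul (hHc j) (pow_le_pow_right₀ hz (by omega)) (by positivity) (by positivity)
    have hAH : H.eval w = w ^ (k * (m * d)) * A.eval s := by
      have h1 : w ^ (k * (m * d)) =
          ((Q - C w).roots.map fun _ => w ^ (k * m)).prod := by
        rw [Multiset.map_const', Multiset.prod_replicate, roots_sub_C_card, ← pow_mul, mul_assoc]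
      rw [hH, eval_multiset_prod, Multiset.map_map, h1, ← Multiset.prod_map_mul]
      refine congrArg _ (Multiset.map_congr rfl fun ζ hζ => ?_)
      have h2 : w ^ (k * m) ≠ 0 := pow_ne_zero _ hw0
      rw [hW]
      simp only [eval_sub, eval_mul, eval_C, eval_pow, eval_of_mem_roots_sub_C hζ, eval_X,
        Function.comp_apply]
      field_simp
    rw [hAH, norm_mul, norm_pow] at hHw
    have h3 : 0 < ‖w‖ ^ (k * (m * d)) := by positivity
    refine le_of_mul_le_mul_left (hHw.trans_eq ?_) h3
    ring
  have hAc : ∀ j, ‖A.coeff j‖ ≤ (k * (m * d) + 1) * 2 ^ d := by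
    intro j
    obtain ⟨v, hv, hle⟩ := exists_norm_coeff_le_norm_eval hL A j
    refine (hle.trans (hAs v)).trans_eq ?_
    rw [hv, one_add_one_eq_two]
  have hroot : A.eval (P.eval z ^ k / w ^ (k * m)) = 0 := by
    rw [eval_multiset_prod, Multiset.map_map]
    refine Multiset.prod_eq_zero (Multiset.mem_map.2 ⟨z, hzroot, ?_⟩)
    simp
  have hfin := norm_root_le_of_norm_coeff_le hAm (hAd ▸ hQ) hAc hroot
  have hd1 : (1 : ℝ) ≤ d := by exact_mod_cast hQ
  rw [hAd, max_eq_right] at hfin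
  · rw [div_pow, ← pow_mul, mul_comm m k, ← norm_pow, ← norm_pow, ← norm_div]
    exact hfin.trans_eq (by ring)
  · have h2 : (1 : ℝ) ≤ 2 ^ d := one_le_pow₀ one_le_two
    have h3 : (1 : ℝ) ≤ k * (m * d) + 1 := by
      have : (0 : ℝ) ≤ k * (m * d) := by positivity
      linarith
    exact one_le_mul_of_one_le_of_one_le hd1 (one_le_mul_of_one_le_of_one_le h3 h2)

/-- Green's functions of lemniscates are monotone. -/
theorem lemniscateGreen_le_of_subset [IsAlgClosed L] (hL : HasContractiveMeans L) {P Q : L[X]}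
    (hP : 0 < P.natDegree) (hQ : 0 < Q.natDegree) {a b : L} (ha : a ≠ 0) (hb : b ≠ 0)
    (h : lemniscate Q ‖a‖ ⊆ lemniscate P ‖b‖) (z : L) :
    lemniscateGreen P ‖b‖ z ≤ lemniscateGreen Q ‖a‖ z := by
  have ha' : 0 < ‖a‖ := norm_pos_iff.2 ha
  have hb' : 0 < ‖b‖ := norm_pos_iff.2 hb
  by_cases hz : z ∈ lemniscate Q ‖a‖
  · rw [lemniscateGreen_eq_zero hb' (h hz)]
    exact lemniscateGreen_nonneg _ _ _
  have hQe : ∀ z, ‖(C a⁻¹ * Q).eval z‖ = ‖Q.eval z‖ / ‖a‖ := fun z => by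
    rw [eval_mul, eval_C, norm_mul, norm_inv, inv_mul_eq_div]
  have hPe : ∀ z, ‖((C b⁻¹ * P) ^ Q.natDegree).eval z‖ =
      (‖P.eval z‖ / ‖b‖) ^ Q.natDegree := fun z => by
    rw [eval_pow, eval_mul, eval_C, norm_pow, norm_mul, norm_inv, inv_mul_eq_div]
  have hQd : (C a⁻¹ * Q).natDegree = Q.natDegree := natDegree_C_mul (inv_ne_zero ha)
  -- Raising `P` to the power `deg Q` makes its degree the exact multiple `deg P` of `deg Q`.
  have hBW := norm_eval_le_norm_eval_pow hL (P := (C b⁻¹ * P) ^ Q.natDegree) (Q := C a⁻¹ * Q)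
    (hQd ▸ hQ) (m := P.natDegree)
    (by rw [natDegree_pow, natDegree_C_mul (inv_ne_zero hb), hQd, mul_comm])
    (fun y hy => by
      rw [hQe, div_le_one ha'] at hy
      rw [hPe]
      exact pow_le_one₀ (by positivity) ((div_le_one hb').2 (h hy)))
    (z := z) (by
      rw [hQe, one_le_div ha']
      exact (not_le.1 hz).le)
  rw [hQe, hPe] at hBW
  have h1 := Real.posLog_le_posLog (by positivity) hBW
  rw [Real.posLog_pow, Real.posLog_pow] at h1
  rw [lemniscateGreen, lemniscateGreen, one_div_mul_eq_div, one_div_mul_eq_div,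
    div_le_div_iff₀ (by positivity) (by positivity)]
  linarith

/-- An increasing sequence lies below its limit. Thus tautness for `lam` passes to every
approximating lemniscate. -/
theorem lemniscateGreen_le_of_tendsto [IsAlgClosed L] (hL : HasContractiveMeans L) {P : ℕ → L[X]}
    {R : ℕ → ℝ} (hP : ∀ n, 0 < (P n).natDegree) (hR : ∀ n, ∃ a : L, a ≠ 0 ∧ ‖a‖ = R n)
    (hmono : ∀ n, lemniscate (P (n + 1)) (R (n + 1)) ⊆ lemniscate (P n) (R n)) {lam : L → ℝ}
    (hlim : ∀ z, Tendsto (fun n => lemniscateGreen (P n) (R n) z) atTop (𝓝 (lam z))) (n : ℕ)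
    (z : L) : lemniscateGreen (P n) (R n) z ≤ lam z := by
  have hm : Monotone fun n => lemniscateGreen (P n) (R n) z := by
    refine monotone_nat_of_le_succ fun k => ?_
    obtain ⟨a, ha, haR⟩ := hR (k + 1)
    obtain ⟨b, hb, hbR⟩ := hR k
    have h1 := hmono k
    rw [← haR, ← hbR] at h1 ⊢
    exact lemniscateGreen_le_of_subset hL (hP k) (hP (k + 1)) ha hb h1 z
  exact hm.ge_of_tendsto (hlim z) n

/-! ### Upper bound for diameters along taut sequences -/

theorem IsLogDistance.nonneg {F : Set L} {lam : L → ℝ} (h : IsLogDistance F lam) (z : L) :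
    0 ≤ lam z := by
  by_cases hz : z ∈ F
  · exact (h.eq_zero z hz).ge
  · exact (h.pos z hz).le

theorem finsetDiameter_eq {X : Type*} [MetricSpace X] (T : Finset X) :
    ∃ x : Fin T.card → X, (∀ f : X → ℝ, ∑ i, f (x i) = ∑ z ∈ T, f z) ∧ finsetDiameter T =
      (∏ p ∈ (Finset.univ : Finset (Fin T.card)).offDiag, dist (x p.1) (x p.2)) ^
        (1 / ((T.card : ℝ) * ((T.card : ℝ) - 1))) := by
  classical
  refine ⟨fun i => T.equivFin.symm i, fun f => ?_, ?_⟩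
  · rw [Equiv.sum_comp T.equivFin.symm (fun z : T => f z), Finset.sum_coe_sort T f]
  · rw [finsetDiameter]
    congr 1
    refine Finset.prod_bij' (fun p hp => (T.equivFin ⟨p.1, (Finset.mem_offDiag.1 hp).1⟩,
      T.equivFin ⟨p.2, (Finset.mem_offDiag.1 hp).2.1⟩))
      (fun p _ => ((T.equivFin.symm p.1 : X), (T.equivFin.symm p.2 : X))) ?_ ?_ ?_ ?_ ?_
    · intro p hp
      simpa [Finset.mem_offDiag] using (Finset.mem_offDiag.1 hp).2.2
    · intro p hp
      simpa [Finset.mem_offDiag, Subtype.coe_inj] using hp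
    · intro p _; simp
    · intro p _; simp
    · intro p _; simp

/-- Along a taut sequence of growing finite sets, the geometric means of the pairwise distances are
asymptotically bounded by the transfinite diameter. -/
theorem IsGeneralizedGreen.eventually_finsetDiameter_lt [IsAlgClosed L]
    (hL : HasContractiveMeans L) {F : Set L} {lam : L → ℝ} (h : IsGeneralizedGreen F lam)
    {S : ℕ → Finset L} (hS : IsTaut lam S) (hcard : Tendsto (fun n => (S n).card) atTop atTop)
    {c : ℝ} (hc : transfiniteDiameter F < c) : ∀ᶠ n in atTop, finsetDiameter (S n) < c := by
  obtain ⟨P, R, hP, hR, hmono, -, hcap, hlim⟩ := h.exists_lemniscates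
  -- A single lemniscate with capacity below `c` is fixed before `n` varies, so its error term tends
  -- to zero.
  obtain ⟨k, hk⟩ := (hcap.eventually_lt_const hc).exists
  have hle := lemniscateGreen_le_of_tendsto hL hP hR hmono hlim k
  obtain ⟨a, ha, haR⟩ := hR k
  rw [← haR] at hk hle
  rw [transfiniteDiameter_lemniscate hL (hP k) ha] at hk
  have ha' : 0 < ‖a‖ := norm_pos_iff.2 ha
  have hc0 := lemniscateCapacity_pos (hP k) ha'
  obtain ⟨err, herr, hb⟩ := exists_geometricMean_le (hP k) ha'
  have hup : Tendsto (fun n => lemniscateCapacity (P k) ‖a‖ *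
      Real.exp (err (S n).card + 2 * (1 / ((S n).card : ℝ) * ∑ z ∈ S n, lam z))) atTop
      (𝓝 (lemniscateCapacity (P k) ‖a‖)) := by
    have h1 := (herr.comp hcard).add (hS.const_mul 2)
    simp only [mul_zero, add_zero] at h1
    simpa using (Real.continuous_exp.continuousAt.tendsto.comp h1).const_mul
      (lemniscateCapacity (P k) ‖a‖)
  filter_upwards [hup.eventually_lt_const hk, hcard.eventually_ge_atTop 2] with n hn hn2
  refine lt_of_le_of_lt ?_ hn
  obtain ⟨x, hx, hd⟩ := finsetDiameter_eq (S n)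
  rw [hd]
  refine (hb _ hn2 x).trans ?_
  rw [hx]
  gcongr
  exact hle _

/-! ### The unit disc at ultrametric places -/

theorem norm_sub_le_max_of_ultrametric [IsUltrametricDist L] (x y : L) :
    ‖x - y‖ ≤ max ‖x‖ ‖y‖ := by
  rw [sub_eq_add_neg, ← norm_neg y]
  exact IsUltrametricDist.norm_add_le_max x (-y)

theorem norm_sub_eq_max_of_ne [IsUltrametricDist L] {x y : L} (h : ‖x‖ ≠ ‖y‖) :
    ‖x - y‖ = max ‖x‖ ‖y‖ := by
  rw [sub_eq_add_neg, IsUltrametricDist.norm_add_eq_max_of_norm_ne_norm (by rwa [norm_neg]),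
    norm_neg]

/-- Finitely many residue classes do not exhaust the closed unit disc. -/
theorem exists_norm_sub_eq_max_one [IsAlgClosed L] [IsUltrametricDist L] (s : Multiset L) :
    ∃ u : L, ‖u‖ ≤ 1 ∧ ∀ b ∈ s, ‖u - b‖ = max 1 ‖b‖ := by
  classical
  suffices h : ∃ u : L, ‖u‖ ≤ 1 ∧ ∀ b ∈ s.filter (fun b => ‖b‖ ≤ 1), ‖u - b‖ = 1 by
    obtain ⟨u, hu, hs⟩ := h
    refine ⟨u, hu, fun b hb => ?_⟩
    rcases le_or_gt ‖b‖ 1 with h1 | h1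
    · rw [hs b (Multiset.mem_filter.2 ⟨hb, h1⟩), max_eq_left h1]
    · rw [norm_sub_eq_max_of_ne (hu.trans_lt h1).ne, max_eq_right (hu.trans h1.le),
        max_eq_right h1.le]
  set t := s.filter (fun b => ‖b‖ ≤ 1) with ht
  have ht1 : ∀ b ∈ t, ‖b‖ ≤ 1 := fun b hb => (Multiset.mem_filter.1 hb).2
  rcases eq_or_ne t 0 with h0 | h0
  · exact ⟨0, by simp, by simp [h0]⟩
  have hcard : 0 < t.card := Multiset.card_pos.2 h0
  have hgdeg : (t.map fun b => X - C b).prod.natDegree = t.card :=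
    natDegree_multiset_prod_X_sub_C_eq_card t
  -- At a solution of `∏ (u - b) = 1` all factors have norm at most one and product of norms one,
  -- hence every norm is one.
  obtain ⟨u, hu⟩ := IsAlgClosed.exists_root ((t.map fun b => X - C b).prod - C 1) (by
    refine (natDegree_pos_iff_degree_pos.1 ?_).ne'
    rwa [natDegree_sub_C, hgdeg])
  rw [IsRoot.def, eval_sub, eval_C, sub_eq_zero, eval_multiset_prod, Multiset.map_map] at hu
  have hprod : (t.map fun b => ‖u - b‖).prod = 1 := by
    rw [← norm_multiset_prod_map, ← norm_one (α := L), ← hu]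
    simp
  have hu1 : ‖u‖ ≤ 1 := by
    by_contra! h1
    rw [Multiset.map_congr rfl fun b hb => by
      rw [norm_sub_eq_max_of_ne ((ht1 b hb).trans_lt h1).ne', max_eq_left ((ht1 b hb).trans h1.le)],
      Multiset.map_const', Multiset.prod_replicate] at hprod
    exact (one_lt_pow₀ h1 hcard.ne').ne' hprod
  have hle : ∀ b ∈ t, ‖u - b‖ ≤ 1 := fun b hb =>
    (norm_sub_le_max_of_ultrametric u b).trans (max_le hu1 (ht1 b hb))
  refine ⟨u, hu1, fun b hb => le_antisymm (hle b hb) ?_⟩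
  rw [← Multiset.cons_erase hb, Multiset.map_cons, Multiset.prod_cons] at hprod
  have h2 := multiset_prod_map_le_pow (t.erase b) (fun b => ‖u - b‖) 1
    (fun _ _ => norm_nonneg _) (fun c hc => hle c (Multiset.mem_of_mem_erase hc))
  rw [one_pow] at h2
  calc 1 = ‖u - b‖ * ((t.erase b).map fun b => ‖u - b‖).prod := hprod.symm
    _ ≤ ‖u - b‖ * 1 := by gcongr
    _ = _ := mul_one _

theorem transfiniteDiameter_closedUnitDisc [IsAlgClosed L] (hL : HasContractiveMeans L) :
    transfiniteDiameter {z : L | ‖z‖ ≤ 1} = 1 := by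
  have h1 := transfiniteDiameter_lemniscate hL (Q := (X : L[X])) (by simp) (one_ne_zero (α := L))
  simpa [lemniscate, lemniscateCapacity] using h1

/-- A generalized Green's function of the closed unit disc of an algebraically closed ultrametric
field dominates `log⁺ |z|`. -/
theorem IsGeneralizedGreen.posLog_le [IsAlgClosed L] [IsUltrametricDist L]
    (hL : HasContractiveMeans L) {lam : L → ℝ} (h : IsGeneralizedGreen {z : L | ‖z‖ ≤ 1} lam)
    (z : L) : Real.posLog ‖z‖ ≤ lam z := by
  rcases le_or_gt ‖z‖ 1 with hz | hz
  · rw [(Real.posLog_eq_zero_iff _).2 (by simpa using hz)]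
    exact h.isLogDistance.nonneg z
  obtain ⟨P, R, hP, hR, hmono, hinter, hcap, hlim⟩ := h.exists_lemniscates
  have hanti : Antitone fun n => lemniscate (P n) (R n) := antitone_nat_of_succ_le hmono
  rw [transfiniteDiameter_closedUnitDisc hL] at hcap
  have hcap' : Tendsto (fun n => lemniscateCapacity (P n) (R n)) atTop (𝓝 1) := by
    refine hcap.congr fun n => ?_
    obtain ⟨a, ha, haR⟩ := hR n
    rw [← haR]
    exact transfiniteDiameter_lemniscate hL (hP n) ha
  have hRpos : ∀ n, 0 < R n := fun n => by
    obtain ⟨a, ha, haR⟩ := hR n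
    rw [← haR]; exact norm_pos_iff.2 ha
  obtain ⟨n₀, hn₀⟩ : ∃ n₀, z ∉ lemniscate (P n₀) (R n₀) := by
    by_contra! h1
    have : z ∈ {z : L | ‖z‖ ≤ 1} := hinter ▸ Set.mem_iInter.2 h1
    exact absurd this (not_le.2 hz)
  have hclosed : IsClosed (lemniscate (P n₀) (R n₀)) :=
    isClosed_le (P n₀).continuous.norm continuous_const
  obtain ⟨ε, hε, hball⟩ := Metric.isOpen_iff.1 hclosed.isOpen_compl z hn₀
  -- Roots of `P n` lie in its lemniscate, hence for `n ≥ n₀` outside a fixed ball around `z`.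
  have hroot : ∀ n, n₀ ≤ n → ∀ b ∈ (P n).roots, ε ≤ ‖z - b‖ := by
    intro n hn b hb
    by_contra! hlt
    refine hball (show b ∈ Metric.ball z ε by rwa [Metric.mem_ball, dist_comm, dist_eq_norm]) ?_
    refine hanti hn ?_
    change ‖(P n).eval b‖ ≤ R n
    rw [(mem_roots'.1 hb).2, norm_zero]
    exact (hRpos n).le
  set r := ‖z‖ with hr
  have hr0 : 0 < r := by linarith
  have hlr : 0 < Real.log r := Real.log_pos hz
  -- The exponent is chosen so that `ε * r ^ s ≥ r`: a root `b` with `‖b‖ ≥ r` may be as near to `z`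
  -- as `ε`, and the factor `max 1 ‖b‖ ^ s` makes up for it.
  set s : ℝ := max 0 (Real.log (r / ε) / Real.log r) with hs
  have hs0 : 0 ≤ s := le_max_left _ _
  have hfac : ∀ n, n₀ ≤ n → ∀ b ∈ (P n).roots, r ≤ ‖z - b‖ * max 1 ‖b‖ ^ s := by
    intro n hn b hb
    rcases lt_or_ge ‖b‖ r with hlt | hge
    · rw [norm_sub_eq_max_of_ne hlt.ne', ← hr, max_eq_left hlt.le]
      exact le_mul_of_one_le_right hr0.le (Real.one_le_rpow (le_max_left _ _) hs0)
    · calc r = ε * (r / ε) := by field_simp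
        _ = ε * r ^ (Real.log (r / ε) / Real.log r) := by
          rw [Real.rpow_def_of_pos hr0, mul_div_cancel₀ _ hlr.ne', Real.exp_log (by positivity)]
        _ ≤ ‖z - b‖ * max 1 ‖b‖ ^ s := by
          refine mul_le_mul (hroot n hn b hb) ?_ (by positivity) (norm_nonneg _)
          exact (Real.rpow_le_rpow_of_exponent_le hz.le (le_max_right _ _)).trans
            (Real.rpow_le_rpow hr0.le (hge.trans (le_max_right _ _)) hs0)
  have hmain : ∀ n, n₀ ≤ n → r ≤ Real.exp (lemniscateGreen (P n) (R n) z) *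
      (lemniscateCapacity (P n) (R n) * lemniscateCapacity (P n) (R n) ^ s) := by
    intro n hn
    have hc0 := lemniscateCapacity_pos (hP n) (hRpos n)
    have hlc : 0 < ‖(P n).leadingCoeff‖ := by
      rw [norm_pos_iff, leadingCoeff_ne_zero]
      intro h0
      have := hP n
      simp [h0] at this
    obtain ⟨u, hu1, hu⟩ := exists_norm_sub_eq_max_one (P n).roots
    have hPu : ‖(P n).eval u‖ ≤ R n :=
      Set.mem_iInter.1 (hinter.symm ▸ hu1 : u ∈ ⋂ n, lemniscate (P n) (R n)) n
    -- The point `u` of the unit disc realises the Gauss norm of `P n`. As the disc lies in the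
    -- lemniscate, the Mahler-type product is at most `c ^ deg`, and `c → 1` makes the correction
    -- disappear.
    have hM : ((P n).roots.map fun b => max 1 ‖b‖).prod ≤
        lemniscateCapacity (P n) (R n) ^ (P n).natDegree := by
      rw [lemniscateCapacity_pow (hP n) (hRpos n), le_div_iff₀' hlc]
      rw [(IsAlgClosed.splits (P n)).eval_eq_prod_roots u, norm_mul, norm_multiset_prod_map,
        Multiset.map_congr rfl hu] at hPu
      exact hPu
    have hprod := Multiset.prod_map_le_prod_map₀ (s := (P n).roots) (fun _ => r)
      (fun b => ‖z - b‖ * max 1 ‖b‖ ^ s) (fun _ _ => hr0.le) (hfac n hn)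
    rw [Multiset.map_const', Multiset.prod_replicate,
      ← (IsAlgClosed.splits (P n)).natDegree_eq_card_roots, Multiset.prod_map_mul,
      Real.multiset_prod_map_rpow _ _ (fun _ _ => by positivity)] at hprod
    have hz1 : ((P n).roots.map fun b => ‖z - b‖).prod =
        ‖(P n).eval z‖ / R n * lemniscateCapacity (P n) (R n) ^ (P n).natDegree := by
      have := hRpos n
      rw [(IsAlgClosed.splits (P n)).eval_eq_prod_roots z, norm_mul, norm_multiset_prod_map,
        lemniscateCapacity_pow (hP n) (hRpos n)]
      field_simp
    refine le_of_pow_le_pow_left₀ (hP n).ne' (by positivity) (hprod.trans ?_)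
    rw [hz1, mul_pow, mul_pow, mul_assoc]
    have h1 := le_exp_lemniscateGreen_pow (hP n) (hRpos n) z
    have hM0 : 0 ≤ ((P n).roots.map fun b => max 1 ‖b‖).prod := by
      refine Multiset.prod_nonneg fun x hx => ?_
      obtain ⟨b, -, rfl⟩ := Multiset.mem_map.1 hx
      positivity
    have h2 : ((P n).roots.map fun b => max 1 ‖b‖).prod ^ s ≤
        (lemniscateCapacity (P n) (R n) ^ s) ^ (P n).natDegree := by
      rw [← Real.rpow_natCast, ← Real.rpow_mul hc0.le, mul_comm s, Real.rpow_mul hc0.le,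
        Real.rpow_natCast]
      exact Real.rpow_le_rpow hM0 hM hs0
    gcongr
  have hlim' : Tendsto (fun n => Real.exp (lemniscateGreen (P n) (R n) z) *
      (lemniscateCapacity (P n) (R n) * lemniscateCapacity (P n) (R n) ^ s)) atTop
      (𝓝 (Real.exp (lam z) * (1 * 1 ^ s))) :=
    (Real.continuous_exp.continuousAt.tendsto.comp (hlim z)).mul
      (hcap'.mul (hcap'.rpow_const (Or.inr hs0)))
  have hfinal := ge_of_tendsto hlim' (eventually_atTop.2 ⟨n₀, hmain⟩)
  rw [Real.one_rpow, mul_one, mul_one] at hfinal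
  rw [Real.posLog_eq_log (by simpa [hr] using hz.le)]
  exact (Real.log_le_iff_le_exp hr0).2 hfinal

theorem IsGeneralizedGreen.transfiniteDiameter_nonneg [IsAlgClosed L]
    (hL : HasContractiveMeans L) {F : Set L} {lam : L → ℝ} (h : IsGeneralizedGreen F lam) :
    0 ≤ transfiniteDiameter F := by
  obtain ⟨P, R, hP, hR, -, -, hcap, -⟩ := h.exists_lemniscates
  refine ge_of_tendsto' hcap fun n => ?_
  obtain ⟨a, ha, haR⟩ := hR n
  rw [← haR, transfiniteDiameter_lemniscate hL (hP n) ha]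
  exact (lemniscateCapacity_pos (hP n) (norm_pos_iff.2 ha)).le

theorem sum_offDiag_univ_add {N : ℕ} (f : Fin N → ℝ) :
    ∑ p ∈ (Finset.univ : Finset (Fin N)).offDiag, (f p.1 + f p.2) =
      2 * ((N : ℝ) - 1) * ∑ i, f i := by
  have h1 : ∑ p ∈ (Finset.univ : Finset (Fin N)) ×ˢ Finset.univ, (f p.1 + f p.2) =
      2 * N * ∑ i, f i := by
    rw [Finset.sum_product]
    simp only [Finset.sum_add_distrib, Finset.sum_const, Finset.card_univ, Fintype.card_fin,
      nsmul_eq_mul, ← Finset.mul_sum]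
    ring
  rw [← Finset.diag_union_offDiag, Finset.sum_union (Finset.disjoint_diag_offDiag _),
    Finset.sum_diag, Finset.sum_add_distrib] at h1
  linarith

/-- In an ultrametric field, the geometric mean of the pairwise distances of a finite set is
bounded by the exponential of twice the mean of `log⁺ |z|`. -/
theorem finsetDiameter_le_exp [IsUltrametricDist L] {T : Finset L} (hT : 2 ≤ T.card) :
    finsetDiameter T ≤ Real.exp (2 * (1 / (T.card : ℝ) * ∑ z ∈ T, Real.posLog ‖z‖)) := by
  obtain ⟨x, hx, hd⟩ := finsetDiameter_eq T
  rw [hd]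
  refine rpow_le_of_le_pow hT (Finset.prod_nonneg fun _ _ => dist_nonneg) (Real.exp_pos _).le ?_
  -- The ultrametric inequality gives this bound with constant one, so no error term accumulates
  -- when places are summed.
  have h1 : ∀ z w : L, dist z w ≤ Real.exp (Real.posLog ‖z‖ + Real.posLog ‖w‖) := by
    intro z w
    rw [Real.exp_add, Real.posLog_eq_log_max_one (norm_nonneg _),
      Real.posLog_eq_log_max_one (norm_nonneg _), Real.exp_log (by positivity),
      Real.exp_log (by positivity), dist_eq_norm]
    refine (norm_sub_le_max_of_ultrametric z w).trans (max_le ?_ ?_)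
    · exact (le_max_right 1 _).trans (le_mul_of_one_le_right (by positivity) (le_max_left _ _))
    · exact (le_max_right 1 _).trans (le_mul_of_one_le_left (by positivity) (le_max_left _ _))
  refine (Finset.prod_le_prod (fun _ _ => dist_nonneg) fun p _ => h1 (x p.1) (x p.2)).trans ?_
  rw [← Real.exp_sum, sum_offDiag_univ_add fun i => Real.posLog ‖x i‖,
    hx fun z => Real.posLog ‖z‖, ← Real.exp_nat_mul, Nat.cast_mul, Nat.cast_sub (by omega)]
  have : (0 : ℝ) < T.card := by positivity
  refine le_of_eq (congrArg _ ?_)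
  push_cast
  field_simp

end Local

/-! ### Algebraic closedness and contractive means of the local fields -/

/-- A complete normed field with a dense algebraically closed subfield is algebraically closed. -/
theorem isAlgClosed_of_denseRange {K L : Type*} [Field K] [IsAlgClosed K] [NormedField L]
    [CompleteSpace L] (φ : K →+* L) (hφ : DenseRange φ) : IsAlgClosed L := by
  let _ : Algebra K L := φ.toAlgebra
  have hdense : DenseRange (algebraMap K L) := hφ
  refine IsAlgClosed.of_exists_root L fun f hf hirr => ?_
  set d := f.natDegree with hd
  have hd0 : 0 < d := hirr.natDegree_pos
  -- Calibrated to the continuity of roots: moving coefficients by `2 * ε n` moves a root by at most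
  -- `B * (1 / 2) ^ n`, so successive choices of roots form a Cauchy sequence.
  let ε : ℕ → ℝ := fun n => ((1 / 2) ^ n) ^ d / (2 * (d + 1))
  have hε : ∀ n, 0 < ε n := fun n => by positivity
  have hεle : ∀ n, ε (n + 1) ≤ ε n := fun n => by
    simp only [ε]
    gcongr ?_ ^ d / _
    exact pow_le_pow_of_le_one (by norm_num) (by norm_num) (Nat.le_succ n)
  have hε0 : Tendsto ε atTop (𝓝 0) := by
    have h1 := (tendsto_pow_atTop_nhds_zero_of_lt_one (r := (1 / 2 : ℝ)) (by norm_num)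
      (by norm_num)).pow d
    rw [zero_pow hd0.ne'] at h1
    simpa [ε] using h1.div_const (2 * ((d : ℝ) + 1))
  choose g₀ hg₀m hg₀d hg₀c using fun n =>
    exists_monic_and_natDegree_eq_and_norm_map_algebraMap_coeff_sub_lt hdense hf (hε n)
  let g : ℕ → L[X] := fun n => (g₀ n).map (algebraMap K L)
  have hgm : ∀ n, (g n).Monic := fun n => (hg₀m n).map _
  have hgd : ∀ n, (g n).natDegree = d := fun n => by
    rw [hd, hg₀d n]; exact natDegree_map _
  have hgs : ∀ n, (g n).Splits := fun n => (IsAlgClosed.splits (g₀ n)).map _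
  have hgc : ∀ n i, ‖(g n).coeff i - f.coeff i‖ < ε n := hg₀c
  have hlim : ∀ i, Tendsto (fun n => (g n).coeff i) atTop (𝓝 (f.coeff i)) := fun i => by
    rw [tendsto_iff_norm_sub_tendsto_zero]
    exact squeeze_zero (fun _ => norm_nonneg _) (fun n => (hgc n i).le) hε0
  obtain ⟨B, hB1, hB⟩ : ∃ B : ℝ, 1 ≤ B ∧ ∀ n b, (g n).eval b = 0 → ‖b‖ ≤ B := by
    let A : ℝ := ∑ i ∈ Finset.range (d + 1), ‖f.coeff i‖ + ε 0
    have hA : ∀ n i, ‖(g n).coeff i‖ ≤ A := by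
      intro n i
      have hA0 : 0 ≤ ∑ i ∈ Finset.range (d + 1), ‖f.coeff i‖ :=
        Finset.sum_nonneg fun _ _ => norm_nonneg _
      rcases le_or_gt i d with hi | hi
      · have h1 : ‖f.coeff i‖ ≤ ∑ i ∈ Finset.range (d + 1), ‖f.coeff i‖ :=
          Finset.single_le_sum (f := fun i => ‖f.coeff i‖) (fun _ _ => norm_nonneg _)
            (Finset.mem_range.2 (by omega))
        have h2 : ε n ≤ ε 0 := antitone_nat_of_succ_le hεle (Nat.zero_le n)
        have h3 := norm_le_norm_add_norm_sub' ((g n).coeff i) (f.coeff i)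
        have h4 := hgc n i
        simp only [A]
        linarith
      · rw [coeff_eq_zero_of_natDegree_lt (by rw [hgd]; exact hi), norm_zero]
        have := hε 0
        positivity
    refine ⟨max 1 (d * A), le_max_left _ _, fun n b hb => ?_⟩
    have := norm_root_le_of_norm_coeff_le (hgm n) (by rw [hgd]; exact hd0) (hA n) hb
    rwa [hgd] at this
  have hstep : ∀ n (a : {b // (g n).eval b = 0}), ∃ b : {b // (g (n + 1)).eval b = 0},
      dist (a : L) b ≤ B * (1 / 2) ^ n := by
    intro n a
    obtain ⟨b, hb, hlt⟩ := exists_roots_norm_sub_lt_of_norm_coeff_sub_lt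
      (f := g n) (g := g (n + 1)) (ε := 2 * ε n) (by have := hε n; positivity) a.2 (hgm n)
      (hgm (n + 1)) (by rw [hgd, hgd]) (fun i => by
        have h1 := hgc n i
        have h2 := hgc (n + 1) i
        have h3 := norm_sub_le_norm_sub_add_norm_sub ((g (n + 1)).coeff i) (f.coeff i)
          ((g n).coeff i)
        rw [norm_sub_rev (f.coeff i)] at h3
        linarith [hεle n]) (hgs (n + 1))
    refine ⟨⟨b, (mem_roots'.1 hb).2⟩, ?_⟩
    rw [dist_eq_norm]
    refine hlt.le.trans ?_
    have h1 : (((g n).natDegree : ℝ) + 1) * (2 * ε n) = ((1 / 2) ^ n) ^ d := by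
      rw [hgd]
      simp only [ε]
      field_simp
    rw [h1, hgd, Real.pow_rpow_inv_natCast (by positivity) hd0.ne', mul_comm]
    gcongr
    exact max_le (hB n a a.2) hB1
  choose next hnext using hstep
  obtain ⟨b₀, hb₀⟩ : ∃ b, (g 0).eval b = 0 := by
    obtain ⟨b, hb⟩ := (hgs 0).exists_eval_eq_zero (by
      refine (natDegree_pos_iff_degree_pos.1 ?_).ne'
      rw [hgd]; exact hd0)
    exact ⟨b, hb⟩
  let s : ∀ n, {b // (g n).eval b = 0} := fun n => Nat.rec ⟨b₀, hb₀⟩ next n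
  let t : ℕ → L := fun n => (s n).1
  have hdist : ∀ n, dist (t n) (t (n + 1)) ≤ B * (1 / 2) ^ n := fun n => hnext n (s n)
  have hcauchy : CauchySeq t := cauchySeq_of_le_geometric (1 / 2) B (by norm_num) hdist
  obtain ⟨a, ha⟩ := cauchySeq_tendsto_of_complete hcauchy
  refine ⟨a, ?_⟩
  have h1 : Tendsto (fun n => (g n).eval (t n)) atTop (𝓝 (f.eval a)) := by
    have h2 : Tendsto (fun n => ∑ i ∈ Finset.range (d + 1), (g n).coeff i * t n ^ i) atTop
        (𝓝 (∑ i ∈ Finset.range (d + 1), f.coeff i * a ^ i)) :=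
      tendsto_finsetSum _ fun i _ => (hlim i).mul (ha.pow i)
    rw [eval_eq_sum_range]
    refine h2.congr fun n => ?_
    rw [eval_eq_sum_range, hgd]
  refine tendsto_nhds_unique h1 ?_
  simp [fun n => show (g n).eval (t n) = 0 from (s n).2]

theorem hasContractiveMeans_of_isUltrametricDist (L : Type*) [NormedField L]
    [IsUltrametricDist L] : HasContractiveMeans L := by
  intro n
  -- Two consecutive integers cannot both have norm less than one, since their difference is one.
  obtain ⟨m, hm, hm1⟩ : ∃ m : ℕ, n < m ∧ ‖(m : L)‖ = 1 := by
    have h1 := IsUltrametricDist.norm_natCast_le_one L (n + 1)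
    have h2 := IsUltrametricDist.norm_natCast_le_one L (n + 2)
    rcases h1.lt_or_eq with h1 | h1
    · refine ⟨n + 2, by omega, le_antisymm h2 ?_⟩
      by_contra! h3
      have h4 := norm_sub_le_max_of_ultrametric (((n + 2 : ℕ)) : L) ((n + 1 : ℕ) : L)
      have h5 : (((n + 2 : ℕ)) : L) - ((n + 1 : ℕ) : L) = 1 := by push_cast; ring
      rw [h5, norm_one] at h4
      exact absurd h4 (not_le.2 (max_lt h3 h1))
    · exact ⟨n + 1, by omega, h1⟩
  refine ⟨m, hm, fun h => by simp [h] at hm1, fun f B hf => ?_⟩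
  rw [hm1, one_mul]
  exact IsUltrametricDist.norm_sum_le_of_forall_le_of_nonneg
    ((norm_nonneg _).trans (hf 0 (by omega))) fun i hi => hf i (Finset.mem_range.1 hi)

theorem hasContractiveMeans_of_norm_natCast {L : Type*} [NormedField L]
    (h : ∀ n : ℕ, ‖(n : L)‖ = n) : HasContractiveMeans L := by
  intro n
  refine ⟨n + 1, by omega, fun h0 => ?_, fun f B hf => ?_⟩
  · have := h (n + 1)
    rw [h0, norm_zero] at this
    exact absurd this.symm (by positivity)
  · rw [h]
    refine (norm_sum_le_of_le (n := fun _ => B) _ fun i hi => hf i (Finset.mem_range.1 hi)).trans ?_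
    simp

theorem norm_le_one_of_root {L : Type*} [NormedField L] [IsUltrametricDist L] {f : L[X]}
    (hf : f.Monic) (hc : ∀ i, ‖f.coeff i‖ ≤ 1) {x : L} (hx : f.eval x = 0) : ‖x‖ ≤ 1 := by
  by_contra! h
  rcases Nat.eq_zero_or_pos f.natDegree with h0 | h0
  · rw [hf.natDegree_eq_zero.1 h0] at hx
    simp at hx
  obtain ⟨e, he⟩ := Nat.exists_eq_succ_of_ne_zero h0.ne'
  rw [eval_eq_sum_range, Finset.sum_range_succ, coeff_natDegree, hf.leadingCoeff, one_mul,
    add_comm] at hx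
  have h1 : ‖x‖ ^ f.natDegree ≤ ‖x‖ ^ e := by
    rw [← norm_pow, eq_neg_of_add_eq_zero_left hx, norm_neg]
    refine IsUltrametricDist.norm_sum_le_of_forall_le_of_nonneg (by positivity) fun j hj => ?_
    rw [norm_mul, norm_pow]
    have hj' := Finset.mem_range.1 hj
    calc ‖f.coeff j‖ * ‖x‖ ^ j ≤ 1 * ‖x‖ ^ e := by
          gcongr
          · exact hc j
          · exact h.le
          · omega
      _ = _ := one_mul _
  rw [he] at h1
  exact absurd h1 (not_le.2 (pow_lt_pow_right₀ h (Nat.lt_succ_self e)))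

/-! ### Local norms of algebraic elements and discriminants of Galois-stable sets -/

section Global

variable {K : Type*} [Field K] {M : Type*} (G : ProductFormula K M)

theorem ProductFormula.norm_toCv (v : M) (x : K) : ‖G.toCv v x‖ = G.abv v x := by
  change ‖((WithAbs.toAbs (G.closureAbv v) (algebraMap (G.abv v).Completion _
    ((WithAbs.toAbs (G.abv v) x : WithAbs (G.abv v)) : (G.abv v).Completion)) :
      WithAbs (G.closureAbv v)) : G.Cv v)‖ = _
  rw [UniformSpace.Completion.norm_coe, WithAbs.norm_toAbs_eq, G.closureAbv_algebraMap,
    UniformSpace.Completion.norm_coe, WithAbs.norm_toAbs_eq]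

theorem ProductFormula.norm_natCast_Cv (v : M) (n : ℕ) : ‖(n : G.Cv v)‖ = G.abv v n := by
  rw [← G.norm_toCv, map_natCast]

instance ProductFormula.isAlgClosed_Cv (v : M) : IsAlgClosed (G.Cv v) := by
  have : IsAlgClosed (WithAbs (G.closureAbv v)) :=
    IsAlgClosed.of_ringEquiv _ _ (WithAbs.equiv (G.closureAbv v)).symm
  exact isAlgClosed_of_denseRange
    (UniformSpace.Completion.coeRingHom : WithAbs (G.closureAbv v) →+* G.Cv v)
    UniformSpace.Completion.denseRange_coe

theorem ProductFormula.isUltrametricDist_Cv {v : M} (h : IsNonarchimedean (G.abv v)) :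
    IsUltrametricDist (G.Cv v) := by
  refine IsUltrametricDist.isUltrametricDist_of_forall_norm_natCast_le_one fun n => ?_
  rw [G.norm_natCast_Cv]
  exact h.apply_natCast_le_one

theorem ProductFormula.hasContractiveMeans_Cv (v : M) : HasContractiveMeans (G.Cv v) := by
  by_cases h : IsNonarchimedean (G.abv v)
  · have := G.isUltrametricDist_Cv h
    exact hasContractiveMeans_of_isUltrametricDist _
  · refine hasContractiveMeans_of_norm_natCast fun n => ?_
    obtain ⟨σ, hσ⟩ := G.exists_complex_embedding v h
    rw [G.norm_natCast_Cv, hσ, map_natCast, Complex.norm_natCast]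

variable {G} (ι : G.Embeddings)

/-- At almost every place the minimal polynomial has coefficients of norm at most one and the norm
is ultrametric, so its roots are integral. -/
theorem ProductFormula.Embeddings.finite_one_lt_norm (z : AlgebraicClosure K) :
    {v | 1 < ‖ι.emb v z‖}.Finite := by
  have hfin : ({v | ¬ IsNonarchimedean (G.abv v)} ∪
      ⋃ i ∈ (minpoly K z).support, {v | G.abv v ((minpoly K z).coeff i) ≠ 1}).Finite := by
    refine G.finite_not_ultrametric.union ((minpoly K z).support.finite_toSet.biUnion fun i hi => ?_)
    exact G.finite_ne_one _ (mem_support_iff.1 hi)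
  refine hfin.subset fun v hv => ?_
  by_contra hv'
  simp only [Set.mem_union, Set.mem_iUnion, not_or, not_exists] at hv'
  have hna : IsNonarchimedean (G.abv v) := not_not.1 hv'.1
  have := G.isUltrametricDist_Cv hna
  refine absurd hv (not_lt.2 (norm_le_one_of_root (f := (minpoly K z).map (G.toCv v))
    ((minpoly.monic (Algebra.IsIntegral.isIntegral z)).map _) (fun i => ?_) ?_))
  · rw [coeff_map, G.norm_toCv]
    by_cases hi : i ∈ (minpoly K z).support
    · exact (not_not.1 (hv'.2 i hi)).le
    · rw [notMem_support_iff.1 hi, map_zero]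
      exact zero_le_one
  · have h1 : G.toCv v = (ι.emb v).comp (algebraMap K (AlgebraicClosure K)) :=
      RingHom.ext fun x => (ι.emb_algebraMap v x).symm
    rw [eval_map, h1, ← hom_eval₂, ← aeval_def, minpoly.aeval, map_zero]

theorem ProductFormula.sum_log_eq_zero {x : K} (hx : x ≠ 0) {U : Finset M}
    (hU : ∀ v, G.abv v x ≠ 1 → v ∈ U) : ∑ v ∈ U, G.weight v * Real.log (G.abv v x) = 0 := by
  have h1 := G.prod_eq_one x hx
  rw [finprod_eq_prod_of_mulSupport_subset (s := U)] at h1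
  · have h2 := congrArg Real.log h1
    rw [Real.log_one, Real.log_prod fun v _ =>
      (Real.rpow_pos_of_pos ((G.abv v).pos hx) _).ne'] at h2
    rw [← h2]
    exact Finset.sum_congr rfl fun v _ => (Real.log_rpow ((G.abv v).pos hx) _).symm
  · intro v hv
    refine hU v fun h => hv ?_
    simp [h]

/-- Separability makes the number of conjugates equal to the degree, and all conjugates belong to
`S`. -/
theorem natDegree_minpoly_le_card {S : Finset (AlgebraicClosure K)} (hS : IsGaloisStable S)
    {z : AlgebraicClosure K} (hz : z ∈ S) (hsep : IsSeparable K z) :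
    (minpoly K z).natDegree ≤ S.card := by
  classical
  rw [← card_rootSet_eq_natDegree (K := AlgebraicClosure K) hsep (IsAlgClosed.splits _),
    ← Set.toFinset_card]
  refine Finset.card_le_card fun y hy => ?_
  rw [Set.mem_toFinset, mem_rootSet] at hy
  obtain ⟨σ, hσ⟩ := isConjRoot_iff_exists_algEquiv.1
    (isConjRoot_of_aeval_eq_zero (Algebra.IsIntegral.isIntegral z) hy.2).symm
  exact hσ ▸ hS σ z hz

theorem galoisOrbit_subset {S : Finset (AlgebraicClosure K)} (hS : IsGaloisStable S)
    {z : AlgebraicClosure K} (hz : z ∈ S) : galoisOrbit z ⊆ S := by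
  intro y hy
  obtain ⟨σ, rfl⟩ := (galoisOrbit_finite K z).mem_toFinset.1 hy
  exact hS σ z hz

theorem card_galoisOrbit_pos (z : AlgebraicClosure K) : 0 < (galoisOrbit z).card :=
  Finset.card_pos.2 ⟨z, (galoisOrbit_finite K z).mem_toFinset.2 (MulAction.mem_orbit_self z)⟩

open Classical in
/-- The discriminant of a Galois-stable set of separable elements lies in the base field. -/
theorem exists_algebraMap_eq_prod_offDiag {S : Finset (AlgebraicClosure K)}
    (hS : IsGaloisStable S) (hsep : ∀ x ∈ S, IsSeparable K x) :
    ∃ x : K, x ≠ 0 ∧ algebraMap K (AlgebraicClosure K) x = ∏ p ∈ S.offDiag, (p.1 - p.2) := by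
  set δ := ∏ p ∈ S.offDiag, (p.1 - p.2) with hδ
  have hδ0 : δ ≠ 0 := Finset.prod_ne_zero_iff.2 fun p hp =>
    sub_ne_zero_of_ne (Finset.mem_offDiag.1 hp).2.2
  have hδsep : IsSeparable K δ := by
    rw [← mem_separableClosure_iff]
    refine prod_mem fun p hp => sub_mem ?_ ?_
    · exact mem_separableClosure_iff.2 (hsep _ (Finset.mem_offDiag.1 hp).1)
    · exact mem_separableClosure_iff.2 (hsep _ (Finset.mem_offDiag.1 hp).2.1)
  have hfix : ∀ σ : AlgebraicClosure K ≃ₐ[K] AlgebraicClosure K, σ δ = δ := by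
    intro σ
    rw [hδ, map_prod]
    refine Finset.prod_bij' (fun p _ => (σ p.1, σ p.2)) (fun p _ => (σ.symm p.1, σ.symm p.2))
      ?_ ?_ ?_ ?_ ?_
    · intro p hp
      rw [Finset.mem_offDiag] at hp ⊢
      exact ⟨hS σ _ hp.1, hS σ _ hp.2.1, fun h => hp.2.2 (σ.injective h)⟩
    · intro p hp
      rw [Finset.mem_offDiag] at hp ⊢
      exact ⟨hS σ.symm _ hp.1, hS σ.symm _ hp.2.1, fun h => hp.2.2 (σ.symm.injective h)⟩
    · intro p _; simp
    · intro p _; simp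
    · intro p _; simp
  -- Being fixed by every automorphism, `δ` forms a Galois-stable singleton; separability then gives
  -- degree one.
  have hdeg : (minpoly K δ).natDegree ≤ 1 := by
    refine (natDegree_minpoly_le_card (S := {δ}) (fun σ x hx => ?_) (Finset.mem_singleton_self _)
      hδsep).trans_eq (Finset.card_singleton _)
    rw [Finset.mem_singleton] at hx ⊢
    rw [hx, hfix]
  have hδint : IsIntegral K δ := Algebra.IsIntegral.isIntegral δ
  have hdeg1 : (minpoly K δ).degree = 1 :=
    (degree_eq_iff_natDegree_eq_of_pos one_pos).2
      (le_antisymm hdeg (minpoly.natDegree_pos hδint))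
  obtain ⟨x, hx⟩ := minpoly.mem_range_of_degree_eq_one K δ hdeg1
  refine ⟨x, ?_, hx⟩
  rintro rfl
  exact hδ0 (by rw [← hx, map_zero])

theorem ProductFormula.Embeddings.card_image (v : M) (S : Finset (AlgebraicClosure K)) :
    (ι.image v S).card = S.card := Finset.card_map _

theorem ProductFormula.Embeddings.sum_image (v : M) (S : Finset (AlgebraicClosure K))
    (f : G.Cv v → ℝ) : ∑ z ∈ ι.image v S, f z = ∑ z ∈ S, f (ι.emb v z) := Finset.sum_map _ _ _

/-- The local diameters of a Galois-stable set are governed by one element of the base field. -/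
theorem ProductFormula.Embeddings.exists_finsetDiameter_eq {S : Finset (AlgebraicClosure K)}
    (hS : IsGaloisStable S) (hsep : ∀ x ∈ S, IsSeparable K x) :
    ∃ x : K, x ≠ 0 ∧ ∀ v, finsetDiameter (ι.image v S) =
      G.abv v x ^ (1 / ((S.card : ℝ) * ((S.card : ℝ) - 1))) := by
  classical
  obtain ⟨x, hx0, hx⟩ := exists_algebraMap_eq_prod_offDiag hS hsep
  refine ⟨x, hx0, fun v => ?_⟩
  rw [finsetDiameter, ι.card_image]
  congr 1
  rw [← G.norm_toCv, ← ι.emb_algebraMap, hx, map_prod, norm_prod]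
  symm
  refine Finset.prod_bij (fun p _ => (ι.emb v p.1, ι.emb v p.2)) ?_ ?_ ?_ ?_
  · intro p hp
    rw [Finset.mem_offDiag] at hp ⊢
    exact ⟨Finset.mem_map_of_mem _ hp.1, Finset.mem_map_of_mem _ hp.2.1,
      fun h => hp.2.2 ((ι.emb v).injective h)⟩
  · intro p _ q _ h
    simp only [Prod.mk.injEq] at h
    exact Prod.ext ((ι.emb v).injective h.1) ((ι.emb v).injective h.2)
  · rintro ⟨a, b⟩ hp
    rw [Finset.mem_offDiag] at hp
    obtain ⟨a', ha', rfl⟩ := Finset.mem_map.1 hp.1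
    obtain ⟨b', hb', rfl⟩ := Finset.mem_map.1 hp.2.1
    exact ⟨(a', b'), Finset.mem_offDiag.2 ⟨ha', hb', fun h => hp.2.2 (congrArg (ι.emb v) h)⟩, rfl⟩
  · intro p _
    rw [map_sub, dist_eq_norm]

end Global

/-! ### Heights, Northcott finiteness and the global inequality -/

section Global

variable {K : Type*} [Field K] {M : Type*} {G : ProductFormula K M} (ι : G.Embeddings)
  {F : ∀ v, Set (G.Cv v)} {lam : ∀ v, G.Cv v → ℝ}

theorem ProductFormula.IsAdelicSet.exists_finset_bad (hF : G.IsAdelicSet F) :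
    ∃ E : Finset M, ∀ v ∉ E, F v = {z | ‖z‖ ≤ 1} ∧ IsNonarchimedean (G.abv v) := by
  refine ⟨(hF.union G.finite_not_ultrametric).toFinset, fun v hv => ?_⟩
  rw [Set.Finite.mem_toFinset, Set.mem_union, not_or] at hv
  exact ⟨not_not.1 hv.1, not_not.1 hv.2⟩

/-- Outside the places of `U`, the set `S` lies in the unit discs. -/
theorem ProductFormula.Embeddings.exists_finset_norm_le_one [DecidableEq M] (E : Finset M)
    (S : Finset (AlgebraicClosure K)) :
    ∃ U : Finset M, E ⊆ U ∧ ∀ v ∉ U, ∀ z ∈ S, ‖ι.emb v z‖ ≤ 1 := by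
  have hfin : (⋃ z ∈ S, {v | 1 < ‖ι.emb v z‖}).Finite :=
    S.finite_toSet.biUnion fun z _ => ι.finite_one_lt_norm z
  refine ⟨E ∪ hfin.toFinset, Finset.subset_union_left, fun v hv z hz => ?_⟩
  by_contra! h
  exact hv (Finset.mem_union_right _
    (hfin.mem_toFinset.2 (Set.mem_biUnion (Finset.mem_coe.2 hz) h)))

theorem ProductFormula.height_eq_sum {S : Finset (AlgebraicClosure K)} {U : Finset M}
    (hU : ∀ v ∉ U, ∀ z ∈ S, lam v (ι.emb v z) = 0) :
    height ι lam S =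
      ∑ v ∈ U, G.weight v * (1 / (S.card : ℝ) * ∑ z ∈ S, lam v (ι.emb v z)) := by
  rw [height, finsum_eq_sum_of_support_subset (s := U), Finset.mul_sum]
  · refine Finset.sum_congr rfl fun v _ => ?_
    rw [← Finset.mul_sum]
    ring
  · intro v hv
    by_contra hvU
    exact hv (Finset.sum_eq_zero fun z hz => by rw [hU v hvU z hz, mul_zero])

theorem ProductFormula.local_le_height {S : Finset (AlgebraicClosure K)} {U : Finset M}
    (hpos : ∀ v z, 0 ≤ lam v z) (hU : ∀ v ∉ U, ∀ z ∈ S, lam v (ι.emb v z) = 0) {v : M}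
    (hv : v ∈ U) :
    G.weight v * (1 / (S.card : ℝ) * ∑ z ∈ S, lam v (ι.emb v z)) ≤ height ι lam S := by
  rw [height_eq_sum ι hU]
  exact Finset.single_le_sum
    (f := fun v => G.weight v * (1 / (S.card : ℝ) * ∑ z ∈ S, lam v (ι.emb v z)))
    (fun v _ => mul_nonneg (G.weight_pos v).le (mul_nonneg (by positivity)
      (Finset.sum_nonneg fun z _ => hpos _ _))) hv

/-- The heights attached to an adelic set are, up to a constant, at least the absolute height. -/
theorem ProductFormula.exists_height_galoisOrbit_le (hF : G.IsAdelicSet F)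
    (hlam : ∀ v, IsGeneralizedGreen (F v) (lam v)) :
    ∃ B : ℝ, 0 ≤ B ∧ ∀ S : Finset (AlgebraicClosure K), IsGaloisStable S → ∀ z ∈ S,
      height ι (fun _ z => Real.posLog ‖z‖) (galoisOrbit z) ≤ S.card * (height ι lam S + B) := by
  classical
  obtain ⟨E, hE⟩ := hF.exists_finset_bad
  choose C hC using fun v => (hlam v).isLogDistance.bounded
  have hC0 : ∀ v, 0 ≤ C v := fun v => (abs_nonneg _).trans (hC v 0)
  refine ⟨∑ v ∈ E, G.weight v * C v,
    Finset.sum_nonneg fun v _ => mul_nonneg (G.weight_pos v).le (hC0 v), fun S hS z hz => ?_⟩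
  obtain ⟨U, hEU, hU⟩ := ι.exists_finset_norm_le_one E S
  have hsub := galoisOrbit_subset hS hz
  have hlamU : ∀ v ∉ U, ∀ z ∈ S, lam v (ι.emb v z) = 0 := fun v hv z hz => by
    refine (hlam v).isLogDistance.eq_zero _ ?_
    rw [(hE v fun h => hv (hEU h)).1]
    exact hU v hv z hz
  have hlogU : ∀ v ∉ U, ∀ y ∈ galoisOrbit z, Real.posLog ‖ι.emb v y‖ = 0 := fun v hv y hy => by
    rw [Real.posLog_eq_zero_iff, abs_norm]
    exact hU v hv y (hsub hy)
  have hScard : (0 : ℝ) < S.card := by exact_mod_cast Finset.card_pos.2 ⟨z, hz⟩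
  have horb : (1 : ℝ) ≤ (galoisOrbit z).card := by exact_mod_cast card_galoisOrbit_pos z
  have hE' : ∑ v ∈ E, G.weight v * C v = ∑ v ∈ U, G.weight v * (if v ∈ E then C v else 0) := by
    rw [← Finset.sum_subset hEU fun v _ hv => by rw [if_neg hv, mul_zero]]
    exact Finset.sum_congr rfl fun v hv => by rw [if_pos hv]
  rw [height_eq_sum ι hlogU, height_eq_sum ι hlamU, hE', ← Finset.sum_add_distrib, Finset.mul_sum]
  refine Finset.sum_le_sum fun v _ => ?_
  have hpt : ∀ y, Real.posLog ‖ι.emb v y‖ ≤ lam v (ι.emb v y) + if v ∈ E then C v else 0 := by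
    intro y
    split_ifs with hv
    · have := (abs_le.1 (hC v (ι.emb v y))).1
      linarith
    · have := G.isUltrametricDist_Cv (hE v hv).2
      rw [add_zero]
      exact ((hE v hv).1 ▸ hlam v).posLog_le (G.hasContractiveMeans_Cv v) _
  -- The orbit may be much smaller than `S`, so sums are compared rather than means. The resulting
  -- factor `S.card` is harmless, as the estimate is used only for bounded cardinality.
  have h1 : 1 / ((galoisOrbit z).card : ℝ) * ∑ y ∈ galoisOrbit z, Real.posLog ‖ι.emb v y‖ ≤
      ∑ y ∈ S, (lam v (ι.emb v y) + if v ∈ E then C v else 0) := by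
    calc _ ≤ 1 * ∑ y ∈ galoisOrbit z, Real.posLog ‖ι.emb v y‖ := by
          refine mul_le_mul_of_nonneg_right ?_ (Finset.sum_nonneg fun _ _ => Real.posLog_nonneg)
          exact (div_le_one (by linarith)).2 horb
      _ ≤ ∑ y ∈ S, Real.posLog ‖ι.emb v y‖ := by
          rw [one_mul]
          exact Finset.sum_le_sum_of_subset_of_nonneg hsub fun _ _ _ => Real.posLog_nonneg
      _ ≤ _ := Finset.sum_le_sum fun y _ => hpt y
  rw [Finset.sum_add_distrib, Finset.sum_const, nsmul_eq_mul] at h1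
  calc _ ≤ G.weight v * _ := mul_le_mul_of_nonneg_left h1 (G.weight_pos v).le
    _ = _ := by field_simp

/-- Under the Northcott property, distinct Galois-stable sets of bounded height have growing
cardinalities. -/
theorem ProductFormula.tendsto_card_atTop (hK : Northcott ι) (hF : G.IsAdelicSet F)
    (hlam : ∀ v, IsGeneralizedGreen (F v) (lam v)) {S : ℕ → Finset (AlgebraicClosure K)}
    (hSinj : Function.Injective S) (hSgal : ∀ n, IsGaloisStable (S n))
    (hSsep : ∀ n, ∀ x ∈ S n, IsSeparable K x)
    (hSheight : Tendsto (fun n => height ι lam (S n)) atTop (𝓝 0)) :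
    Tendsto (fun n => (S n).card) atTop atTop := by
  obtain ⟨B, hB0, hB⟩ := exists_height_galoisOrbit_le ι hF hlam
  refine tendsto_atTop.2 fun b => ?_
  -- If `S n` has fewer than `b` elements and height at most one, all its elements lie in this
  -- finite set, which has only finitely many subsets.
  have hT := hK b (b * (1 + B))
  have hfin : {n | S n ⊆ hT.toFinset}.Finite := by
    have := (hT.toFinset.powerset.finite_toSet).preimage (hSinj.injOn (s := S ⁻¹' _))
    refine this.subset fun n hn => ?_
    rw [Set.mem_preimage, Finset.mem_coe, Finset.mem_powerset]
    exact hn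
  have h1 : ∀ᶠ n in atTop, n ∉ {n | S n ⊆ hT.toFinset} :=
    Nat.cofinite_eq_atTop ▸ hfin.eventually_cofinite_notMem
  filter_upwards [h1, hSheight.eventually_le_const zero_lt_one] with n hn hh
  by_contra! hlt
  refine hn fun z hz => hT.mem_toFinset.2 ⟨?_, ?_⟩
  · exact (natDegree_minpoly_le_card (hSgal n) hz (hSsep n z hz)).trans hlt.le
  · refine (hB (S n) (hSgal n) z hz).trans ?_
    have : ((S n).card : ℝ) ≤ b := by exact_mod_cast hlt.le
    exact (mul_le_mul_of_nonneg_left (add_le_add_left hh B) (by positivity)).trans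
      (mul_le_mul_of_nonneg_right this (by linarith))

/-- The product formula bounds the local diameters of a Galois-stable set from below. -/
theorem ProductFormula.neg_le_sum_log_finsetDiameter {E : Finset M}
    (hE : ∀ v ∉ E, F v = {z | ‖z‖ ≤ 1} ∧ IsNonarchimedean (G.abv v))
    (hlam : ∀ v, IsGeneralizedGreen (F v) (lam v)) {S : Finset (AlgebraicClosure K)}
    (hS : IsGaloisStable S) (hsep : ∀ x ∈ S, IsSeparable K x) (hcard : 2 ≤ S.card) :
    -(2 * height ι lam S) ≤
      ∑ v ∈ E, G.weight v * Real.log (finsetDiameter (ι.image v S)) := by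
  classical
  obtain ⟨x, hx0, hx⟩ := ι.exists_finsetDiameter_eq hS hsep
  obtain ⟨U, hEU, hU⟩ := ι.exists_finset_norm_le_one (E ∪ (G.finite_ne_one x hx0).toFinset) S
  have hE' : E ⊆ U := Finset.subset_union_left.trans hEU
  have hlamU : ∀ v ∉ U, ∀ z ∈ S, lam v (ι.emb v z) = 0 := fun v hv z hz => by
    refine (hlam v).isLogDistance.eq_zero _ ?_
    rw [(hE v fun h => hv (hE' h)).1]
    exact hU v hv z hz
  have hsum : ∑ v ∈ U, G.weight v * Real.log (finsetDiameter (ι.image v S)) = 0 := by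
    have h1 := G.sum_log_eq_zero hx0 (U := U) fun v hv =>
      hEU (Finset.mem_union_right _ ((G.finite_ne_one x hx0).mem_toFinset.2 hv))
    have h2 : ∀ v, Real.log (finsetDiameter (ι.image v S)) =
        1 / ((S.card : ℝ) * ((S.card : ℝ) - 1)) * Real.log (G.abv v x) := fun v => by
      rw [hx, Real.log_rpow ((G.abv v).pos hx0)]
    simp_rw [h2]
    rw [← mul_zero (1 / ((S.card : ℝ) * ((S.card : ℝ) - 1))), ← h1, Finset.mul_sum]
    exact Finset.sum_congr rfl fun v _ => by ring
  have hpos : ∀ v z, 0 ≤ lam v z := fun v z => (hlam v).isLogDistance.nonneg z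
  -- Outside `E` the diameter is controlled by the mean of `log⁺`, hence by that of `lam v`. Adding
  -- the remaining nonnegative local terms completes the height.
  have hout : ∑ v ∈ U \ E, G.weight v * Real.log (finsetDiameter (ι.image v S)) ≤
      2 * height ι lam S := by
    rw [height_eq_sum ι hlamU, Finset.mul_sum]
    refine (Finset.sum_le_sum (g := fun v => 2 * (G.weight v *
      (1 / (S.card : ℝ) * ∑ z ∈ S, lam v (ι.emb v z)))) fun v hv => ?_).trans
      (Finset.sum_le_sum_of_subset_of_nonneg Finset.sdiff_subset fun v _ _ => ?_)
    · have hvE := (Finset.mem_sdiff.1 hv).2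
      have := G.isUltrametricDist_Cv (hE v hvE).2
      have h3 : 0 < finsetDiameter (ι.image v S) := by
        rw [hx]; exact Real.rpow_pos_of_pos ((G.abv v).pos hx0) _
      have h4 := (Real.log_le_iff_le_exp h3).2
        (finsetDiameter_le_exp (T := ι.image v S) (by rwa [ι.card_image]))
      rw [ι.card_image, ι.sum_image] at h4
      have h5 : ∑ z ∈ S, Real.posLog ‖ι.emb v z‖ ≤ ∑ z ∈ S, lam v (ι.emb v z) :=
        Finset.sum_le_sum fun z _ =>
          ((hE v hvE).1 ▸ hlam v).posLog_le (G.hasContractiveMeans_Cv v) _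
      have h6 := h4.trans (mul_le_mul_of_nonneg_left
        (mul_le_mul_of_nonneg_left h5 (by positivity)) zero_le_two)
      exact (mul_le_mul_of_nonneg_left h6 (G.weight_pos v).le).trans_eq (by ring)
    · exact mul_nonneg zero_le_two (mul_nonneg (G.weight_pos v).le (mul_nonneg (by positivity)
        (Finset.sum_nonneg fun z _ => hpos _ _)))
  rw [← Finset.sum_sdiff hE'] at hsum
  linarith

/-- All local terms of the height are nonnegative, so each one is squeezed to zero. -/
theorem ProductFormula.isTaut_image (hF : G.IsAdelicSet F)
    (hlam : ∀ v, IsGeneralizedGreen (F v) (lam v)) {S : ℕ → Finset (AlgebraicClosure K)}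
    (hSheight : Tendsto (fun n => height ι lam (S n)) atTop (𝓝 0)) (v : M) :
    IsTaut (lam v) (fun n => ι.image v (S n)) := by
  classical
  obtain ⟨E, hE⟩ := hF.exists_finset_bad
  have hpos : ∀ v z, 0 ≤ lam v z := fun v z => (hlam v).isLogDistance.nonneg z
  have h0 := hSheight.div_const (G.weight v)
  rw [zero_div] at h0
  refine squeeze_zero (fun n => mul_nonneg (by positivity) (Finset.sum_nonneg fun z _ => hpos _ _))
    (fun n => ?_) h0
  obtain ⟨U, hEU, hU⟩ := ι.exists_finset_norm_le_one (insert v E) (S n)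
  rw [ι.card_image, ι.sum_image, le_div_iff₀' (G.weight_pos v)]
  refine local_le_height ι hpos (fun u hu z hz => ?_) (hEU (Finset.mem_insert_self v E))
  refine (hlam u).isLogDistance.eq_zero _ ?_
  rw [(hE u fun h => hu (hEU (Finset.mem_insert_of_mem h))).1]
  exact hU u hu z hz

/-- If the adelic capacity is one, the local capacities are positive with product one. -/
theorem ProductFormula.sum_log_transfiniteDiameter_eq_zero {E : Finset M}
    (hE : ∀ v ∉ E, F v = {z | ‖z‖ ≤ 1} ∧ IsNonarchimedean (G.abv v))
    (hlam : ∀ v, IsGeneralizedGreen (F v) (lam v)) (hcap : G.capacity F = 1) :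
    (∀ v, 0 < transfiniteDiameter (F v)) ∧
      ∑ v ∈ E, G.weight v * Real.log (transfiniteDiameter (F v)) = 0 := by
  have hout : ∀ v ∉ E, transfiniteDiameter (F v) = 1 := fun v hv => by
    rw [(hE v hv).1]
    exact transfiniteDiameter_closedUnitDisc (G.hasContractiveMeans_Cv v)
  rw [capacity, finprod_eq_prod_of_mulSupport_subset (s := E)] at hcap
  · have hpos : ∀ v, 0 < transfiniteDiameter (F v) := by
      intro v
      by_cases hv : v ∈ E
      · refine lt_of_le_of_ne ((hlam v).transfiniteDiameter_nonneg (G.hasContractiveMeans_Cv v))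
          fun h0 => ?_
        rw [Finset.prod_eq_zero hv (by rw [← h0, Real.zero_rpow (G.weight_pos v).ne'])] at hcap
        exact zero_ne_one hcap
      · rw [hout v hv]; exact one_pos
    refine ⟨hpos, ?_⟩
    have h2 := congrArg Real.log hcap
    rw [Real.log_one, Real.log_prod fun v _ => (Real.rpow_pos_of_pos (hpos v) _).ne'] at h2
    rw [← h2]
    exact Finset.sum_congr rfl fun v _ => (Real.log_rpow (hpos v) _).symm
  · intro v hv
    by_contra hvE
    exact hv (by simp [hout v hvE])

end Global

end AdelicCapacity

/-! ### Pseudo-equidistribution at every place -/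

theorem mainTheorem11 {K : Type*} [Field K] {M : Type*}
    (G : AdelicCapacity.ProductFormula K M) (ι : G.Embeddings)
    (hK : AdelicCapacity.ProductFormula.Northcott ι)
    (F : ∀ v, Set (G.Cv v)) (hF : G.IsAdelicSet F)
    (lam : ∀ v, G.Cv v → ℝ)
    (hlam : ∀ v, AdelicCapacity.IsGeneralizedGreen (F v) (lam v))
    (hcap : G.capacity F = 1)
    (S : ℕ → Finset (AlgebraicClosure K)) (hSinj : Function.Injective S)
    (hSgal : ∀ n, AdelicCapacity.IsGaloisStable (S n))
    (hSsep : ∀ n, ∀ x ∈ S n, IsSeparable K x)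
    (hSheight : Tendsto (fun n => AdelicCapacity.ProductFormula.height ι lam (S n))
      atTop (𝓝 0)) :
    ∀ v, AdelicCapacity.IsPseudoEquidistributed (F v) (lam v) (fun n => ι.image v (S n)) := by
  classical
  intro v
  have hcard := AdelicCapacity.ProductFormula.tendsto_card_atTop ι hK hF hlam hSinj hSgal hSsep
    hSheight
  have hcard' : ∀ u, Tendsto (fun n => (ι.image u (S n)).card) atTop atTop := fun u => by
    simpa only [ι.card_image] using hcard
  have htaut := AdelicCapacity.ProductFormula.isTaut_image ι hF hlam hSheight
  refine ⟨htaut v, hcard' v, ?_⟩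
  obtain ⟨E₀, hE₀⟩ := hF.exists_finset_bad
  set E := insert v E₀ with hEdef
  have hE : ∀ u ∉ E, F u = {z | ‖z‖ ≤ 1} ∧ IsNonarchimedean (G.abv u) := fun u hu =>
    hE₀ u fun h => hu (Finset.mem_insert_of_mem h)
  have hvE : v ∈ E := Finset.mem_insert_self v E₀
  obtain ⟨hcpos, hcsum⟩ :=
    AdelicCapacity.ProductFormula.sum_log_transfiniteDiameter_eq_zero hE hlam hcap
  have hwv := G.weight_pos v
  have hDpos : ∀ n u, 0 < AdelicCapacity.finsetDiameter (ι.image u (S n)) := fun n u => by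
    obtain ⟨x, hx0, hx⟩ := ι.exists_finsetDiameter_eq (hSgal n) (hSsep n)
    rw [hx]
    exact Real.rpow_pos_of_pos ((G.abv u).pos hx0) _
  set W := ∑ u ∈ E.erase v, G.weight u with hW
  have hW0 : 0 ≤ W := Finset.sum_nonneg fun u _ => (G.weight_pos u).le
  have hupper : ∀ ε > 0, ∀ u, ∀ᶠ n in atTop,
      Real.log (AdelicCapacity.finsetDiameter (ι.image u (S n))) <
        Real.log (AdelicCapacity.transfiniteDiameter (F u)) + ε := by
    intro ε hε u
    have h1 : AdelicCapacity.transfiniteDiameter (F u) <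
        AdelicCapacity.transfiniteDiameter (F u) * Real.exp ε :=
      lt_mul_of_one_lt_right (hcpos u) (Real.one_lt_exp_iff.2 hε)
    filter_upwards [(hlam u).eventually_finsetDiameter_lt (G.hasContractiveMeans_Cv u) (htaut u)
      (hcard' u) h1] with n hn
    have h2 := Real.log_lt_log (hDpos n u) hn
    rwa [Real.log_mul (hcpos u).ne' (Real.exp_pos _).ne', Real.log_exp] at h2
  suffices hlog : Tendsto
      (fun n => Real.log (AdelicCapacity.finsetDiameter (ι.image v (S n)))) atTop
      (𝓝 (Real.log (AdelicCapacity.transfiniteDiameter (F v)))) by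
    have h1 := Real.continuous_exp.continuousAt.tendsto.comp hlog
    rw [Real.exp_log (hcpos v)] at h1
    exact h1.congr fun n => Real.exp_log (hDpos n v)
  refine tendsto_order.2 ⟨fun a ha => ?_, fun b hb => ?_⟩
  -- The other places of `E` cost at most `W * ε` and the height at most `2 * ε`; the remaining `ε`
  -- in `(W + 3) * ε` is slack.
  · set ε := (Real.log (AdelicCapacity.transfiniteDiameter (F v)) - a) * G.weight v / (W + 3)
      with hε
    have hε0 : 0 < ε := by
      have : 0 < Real.log (AdelicCapacity.transfiniteDiameter (F v)) - a := by linarith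
      positivity
    filter_upwards [(Finset.eventually_all E).2 fun u _ => hupper ε hε0 u,
      hSheight.eventually_lt_const hε0, hcard.eventually_ge_atTop 2] with n hn hh hn2
    have h1 := AdelicCapacity.ProductFormula.neg_le_sum_log_finsetDiameter ι hE hlam (hSgal n)
      (hSsep n) hn2
    rw [← Finset.add_sum_erase _ _ hvE] at h1 hcsum
    have h2 : ∑ u ∈ E.erase v,
        G.weight u * Real.log (AdelicCapacity.finsetDiameter (ι.image u (S n))) ≤
        ∑ u ∈ E.erase v, G.weight u * Real.log (AdelicCapacity.transfiniteDiameter (F u)) +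
          W * ε := by
      rw [hW, Finset.sum_mul, ← Finset.sum_add_distrib]
      refine Finset.sum_le_sum fun u hu => ?_
      rw [← mul_add]
      exact mul_le_mul_of_nonneg_left (hn u (Finset.mem_of_mem_erase hu)).le (G.weight_pos u).le
    have h3 : ε * (W + 3) =
        (Real.log (AdelicCapacity.transfiniteDiameter (F v)) - a) * G.weight v := by
      rw [hε]; field_simp
    refine lt_of_mul_lt_mul_left ?_ hwv.le
    nlinarith
  · filter_upwards [hupper (b - Real.log (AdelicCapacity.transfiniteDiameter (F v)))
      (by linarith) v] with n hn
    linarith
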